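/- Let $X$ be a Polish space with a compatible metric, let $\mu$ be a non-atomic locally finite Borel measure on $X$, and let $\eta$ be a Poisson point process on $X$ with intensity measure $\mu$. Let $k\ge 1$ and let $f:X^k\to[0,\infty)$ be measurable, $\mu^k$-integrable, essentially bounded and not $\mu^k$-almost everywhere zero; write $\|f\|_\infty$ for its norm in $L^\infty(\mu^k)$. Suppose that $f$ is local with radius $\delta>0$: $f(x_1,\dots,x_k)=0$ whenever two of the points $x_1,\dots,x_k$ have distance larger than $\delta$. Let $$U=\sum_{(x_1,\dots,x_k)\in\eta^k_{\neq}} f(x_1,\dots,x_k)$$ be the U-statistic with kernel $f$, the sum being over all $k$-tuples of distinct points of $\eta$, let $m$ be a median of $U$, and put $E=\sup_{x\in X}\mu(B(x,\delta))$, where $B(x,\delta)$ is the closed ball. Then for every $u>0$ with $$\frac{u^2}{u+m}\ \ge\ E^k e^{2k}\|f\|_\infty$$ we have $$\mathbb P\big(|U-m|\ge u\big)\ \le\ 4\,\mu(X)\,\exp\Big(-\frac1{4k^2}\,\|f\|_\infty^{-1/k}\Big(\frac{u^2}{u+m}\Big)^{1/k}\Big),$$ where the right-hand side is $+\infty$ if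 $\mu(X)=\infty$. -/

import Mathlib

open MeasureTheory ProbabilityTheory

/-- `η : Ω → Set X` is a (simple) Poisson point process on `X` with intensity measure `μ`,
defined on the probability space `(Ω, P)`. A configuration is a locally finite set of points, and
the number of points of `η` in `A` is `(η ω ∩ A).encard`. -/
structure IsPoissonProcess {X : Type*} [TopologicalSpace X] [MeasurableSpace X]
    {Ω : Type*} [MeasurableSpace Ω] (μ : Measure X) (P : Measure Ω) (η : Ω → Set X) : Prop where
  /-- Every realization is a locally finite configuration. -/
  locallyFinite : ∀ ω x, ∃ V ∈ nhds x, (η ω ∩ V).Finite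
  /-- The counts are random variables. -/
  measurable_count : ∀ A : Set X, MeasurableSet A →
    Measurable fun ω => (η ω ∩ A).encard
  /-- The number of points in a set of finite intensity has the Poisson distribution. -/
  poisson_count : ∀ A : Set X, MeasurableSet A → μ A ≠ ⊤ →
    P.map (fun ω => (η ω ∩ A).encard)
      = (poissonMeasure (μ A).toNNReal).map (fun n : ℕ => (n : ℕ∞))
  /-- The numbers of points in finitely many pairwise disjoint sets are independent. -/
  indep_count : ∀ (n : ℕ) (A : Fin n → Set X), (∀ i, MeasurableSet (A i)) →
    Pairwise (fun i j => Disjoint (A i) (A j)) →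
    iIndepFun (fun i ω => (η ω ∩ A i).encard) P

/-- The U-statistic `U(f; η)` of order `k`: the sum of `f` over all `k`-tuples of distinct points
of the configuration `s`. -/
noncomputable def uStatistic {X : Type*} {k : ℕ} (f : (Fin k → X) → ℝ) (s : Set X) : ℝ :=
  ∑' x : {x : Fin k → X // Function.Injective x ∧ ∀ i, x i ∈ s}, f x.1

/-- `f` is a local kernel with radius `δ`: it vanishes at every tuple that has two entries at
distance larger than `δ`. -/
def IsLocalKernel {X : Type*} [MetricSpace X] {k : ℕ} (f : (Fin k → X) → ℝ) (δ : ℝ) : Prop :=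
  ∀ x : Fin k → X, f x ≠ 0 → ∀ i j, x j ∈ Metric.closedBall (x i) δ

/-- `m` is a median of the real random variable `Y`. -/
def IsMedian {Ω : Type*} [MeasurableSpace Ω] (P : Measure Ω) (Y : Ω → ℝ) (m : ℝ) : Prop :=
  1 / 2 ≤ P {ω | Y ω ≤ m} ∧ 1 / 2 ≤ P {ω | m ≤ Y ω}

/-! If `μ` has infinite mass the bound is trivial. Otherwise write `μ = r • ρ` with `ρ` a
probability measure. By its void probabilities, `η` is distributed as the point set of an i.i.d.
sample from `ρ` of Poisson(`r`) size (`IsPoissonProcess.map_eq`), so everything can be proved for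
such samples.

The engine is Talagrand's convex distance inequality, proved for Bernoulli subsets
(`exists_dominatesDistance`, `bernoulliProb_mul_le`). It passes to Poisson samples by drawing two
independent Bernoulli(`r / L`) subsets of the same `L` i.i.d. points, keeping only disjoint pairs,
and letting `L → ∞` (`poissonSampleLaw_mul_le`).

To apply it, let `c = ‖f‖_∞` and define `Q` by `c * Q ^ k = u ^ 2 / (u + m)`. Suppose every point of
a sample has at most `Q` neighbours within `δ`. By locality one point then contributes at most `k *
c * Q ^ (k - 1)` to `U`, while all contributions add up to `k * U`. The normalised contributions are
thus weights of Euclidean norm at most one, and they put the sample at convex distance at least `√Q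
/ k` from a sublevel set of `U` (`exists_weights_of_localSum`). This gives the exponent `Q / (4 * k
^ 2)`. The assumption on `u` says `Q ≥ e² * E`, so a Chernoff bound makes samples with a more
crowded point rare (`poissonSampleLaw_crowded_le`).

Comparing `{U ≤ m}` with `{U ≥ m + u}`, and `{U ≤ m - u}` with `{U ≥ m}`, gives a bound `6 * exp (-Q
/ (4 * k ^ 2))`, which suffices when `r > 3 / 2`. For smaller `r` the tail of the sample size alone
suffices, because `U ≤ c * N ^ k` for a sample of `N` points
(`poissonSampleLaw_abs_sub_median_ge_le`). -/

/-! ### Scalar inequalities for the convex distance induction. -/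

lemma log_two_sub_add_log_add_sq_log_nonneg {q : ℝ} (hq : 0 < q) (hq1 : q ≤ 1) :
    0 ≤ Real.log (2 - q) + Real.log q + Real.log q ^ 2 := by
  -- This is `x` times the derivative; the tangent bound `log x ≤ x - 1` settles its sign. The
  -- function therefore decreases to its value `0` at `1`.
  have key : ∀ x ∈ Set.Ioc (0 : ℝ) 1, 1 - x / (2 - x) + 2 * Real.log x ≤ 0 := by
    intro x hx
    have h1 := Real.log_le_sub_one_of_pos (x := x) hx.1
    have h2 : (0 : ℝ) < 2 - x := by linarith [hx.2]
    have h3 : 1 - x / (2 - x) + 2 * (x - 1) = 2 * (1 - x) * (1 / (2 - x) - 1) := by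
      field_simp; ring
    have h4 : 1 / (2 - x) ≤ 1 := by rw [div_le_one h2]; linarith [hx.2]
    have h5 : 2 * (1 - x) * (1 / (2 - x) - 1) ≤ 0 :=
      mul_nonpos_of_nonneg_of_nonpos (by linarith [hx.2]) (by linarith)
    linarith
  have hd : ∀ x ∈ Set.Ioc (0 : ℝ) 1, HasDerivAt
      (fun x => Real.log (2 - x) + Real.log x + Real.log x ^ 2)
      ((1 - x / (2 - x) + 2 * Real.log x) / x) x := by
    intro x hx
    have h2 : (2 - x : ℝ) ≠ 0 := by linarith [hx.2]
    have hx0 : x ≠ 0 := hx.1.ne'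
    have h := (((hasDerivAt_id x).const_sub 2).log h2).add (Real.hasDerivAt_log hx0) |>.add
      ((Real.hasDerivAt_log hx0).pow 2)
    refine h.congr_deriv ?_
    simp only [id]
    field_simp
    push_cast
    ring
  have hanti : AntitoneOn (fun x => Real.log (2 - x) + Real.log x + Real.log x ^ 2)
      (Set.Ioc (0 : ℝ) 1) := by
    apply antitoneOn_of_deriv_nonpos (convex_Ioc 0 1)
    · exact fun x hx => (hd x hx).continuousAt.continuousWithinAt
    · rw [interior_Ioc]
      exact fun x hx => (hd x ⟨hx.1, hx.2.le⟩).differentiableAt.differentiableWithinAt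
    · rw [interior_Ioc]
      intro x hx
      rw [(hd x ⟨hx.1, hx.2.le⟩).deriv]
      exact div_nonpos_of_nonpos_of_nonneg (key x ⟨hx.1, hx.2.le⟩) hx.1.le
  have := hanti (a := q) (b := 1) ⟨hq, hq1⟩ ⟨one_pos, le_rfl⟩ hq1
  norm_num at this
  exact this

/-- Optimises the interpolation parameter in Talagrand's induction: `exp ((1 - θ) ^ 2 / 4) * q ^
(-θ)` is minimal at `1 - θ = -2 * log q`. If this leaves `[0, 1]`, then `q < e^(-1/2)` and `θ = 0`
is good enough. -/
lemma exists_exp_sq_le_mul_rpow {q : ℝ} (hq : 0 < q) (hq1 : q ≤ 1) :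
    ∃ θ : ℝ, 0 ≤ θ ∧ θ ≤ 1 ∧ Real.exp ((1 - θ) ^ 2 / 4) ≤ (2 - q) * q ^ θ := by
  have hlog : Real.log q ≤ 0 := Real.log_nonpos hq.le hq1
  have h2q : 0 < 2 - q := by linarith
  by_cases h : -1 / 2 ≤ Real.log q
  · refine ⟨1 + 2 * Real.log q, by linarith, by linarith, ?_⟩
    rw [Real.rpow_def_of_pos hq]
    rw [← Real.exp_log h2q, ← Real.exp_add]
    apply Real.exp_le_exp.2
    nlinarith [log_two_sub_add_log_add_sq_log_nonneg hq hq1]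
  · refine ⟨0, le_rfl, zero_le_one, ?_⟩
    push Not at h
    have h1 : q < Real.exp (-1 / 2) := by rwa [← Real.log_lt_iff_lt_exp hq]
    have e1 : Real.exp (1 / 4) ^ 4 = Real.exp 1 := by
      rw [← Real.exp_nat_mul]; norm_num
    have e2 : Real.exp (-1 / 2) ^ 2 * Real.exp 1 = 1 := by
      rw [← Real.exp_nat_mul, ← Real.exp_add]; norm_num
    have e3 := Real.exp_one_lt_d9
    have e4 := Real.exp_one_gt_d9
    have h3 : Real.exp (1 / 4) ≤ 1.3 := by
      by_contra hc
      push Not at hc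
      have : (1.3 : ℝ) ^ 4 ≤ Real.exp (1 / 4) ^ 4 := by gcongr
      norm_num at this
      linarith
    have h4 : Real.exp (-1 / 2) ≤ 0.65 := by
      by_contra hc
      push Not at hc
      have : (0.65 : ℝ) ^ 2 ≤ Real.exp (-1 / 2) ^ 2 := by gcongr
      nlinarith
    norm_num at h3 h4 ⊢
    linarith

/-! ### Talagrand's convex distance inequality on the cube. -/

section Talagrand
variable {ι : Type*} [DecidableEq ι]

/-- The probability that a Bernoulli(`p`) random subset of `J` equals `s ⊆ J`. -/
def bernoulliWeight (p : ℝ) (J s : Finset ι) : ℝ := ∏ i ∈ J, if i ∈ s then p else 1 - p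

open Classical in
/-- The probability that a Bernoulli(`p`) random subset of `J` belongs to `A`. -/
noncomputable def bernoulliProb (p : ℝ) (J : Finset ι) (A : Set (Finset ι)) : ℝ :=
  ∑ s ∈ J.powerset, bernoulliWeight p J s * if s ∈ A then 1 else 0

lemma bernoulliWeight_nonneg {p : ℝ} (hp : 0 ≤ p) (hp1 : p ≤ 1) (J s : Finset ι) :
    0 ≤ bernoulliWeight p J s :=
  Finset.prod_nonneg fun i _ => by split_ifs <;> linarith

lemma bernoulliWeight_insert_of_notMem {p : ℝ} {J s : Finset ι} {a : ι} (ha : a ∉ J)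
    (hs : a ∉ s) : bernoulliWeight p (insert a J) s = (1 - p) * bernoulliWeight p J s := by
  simp [bernoulliWeight, Finset.prod_insert ha, hs]

lemma bernoulliWeight_insert_insert {p : ℝ} {J s : Finset ι} {a : ι} (ha : a ∉ J) :
    bernoulliWeight p (insert a J) (insert a s) = p * bernoulliWeight p J s := by
  unfold bernoulliWeight
  rw [Finset.prod_insert ha]
  simp only [Finset.mem_insert_self, if_true]
  congr 1
  refine Finset.prod_congr rfl fun i hi => ?_
  have : i ≠ a := fun h => ha (h ▸ hi)
  simp [this]

lemma sum_bernoulliWeight_insert {p : ℝ} {J : Finset ι} {a : ι} (ha : a ∉ J)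
    (g : Finset ι → ℝ) :
    ∑ s ∈ (insert a J).powerset, bernoulliWeight p (insert a J) s * g s
      = (1 - p) * ∑ s ∈ J.powerset, bernoulliWeight p J s * g s
        + p * ∑ s ∈ J.powerset, bernoulliWeight p J s * g (insert a s) := by
  rw [Finset.sum_powerset_insert ha, Finset.mul_sum, Finset.mul_sum]
  congr 1
  · refine Finset.sum_congr rfl fun s hs => ?_
    rw [bernoulliWeight_insert_of_notMem ha (fun h => ha (Finset.mem_powerset.1 hs h))]
    ring
  · refine Finset.sum_congr rfl fun s hs => ?_
    rw [bernoulliWeight_insert_insert ha]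
    ring

lemma bernoulliProb_mono {p : ℝ} (hp : 0 ≤ p) (hp1 : p ≤ 1) (J : Finset ι)
    {A B : Set (Finset ι)} (h : A ⊆ B) : bernoulliProb p J A ≤ bernoulliProb p J B := by
  refine Finset.sum_le_sum fun s _ =>
    mul_le_mul_of_nonneg_left ?_ (bernoulliWeight_nonneg hp hp1 J s)
  by_cases hs : s ∈ A
  · simp [hs, h hs]
  · simp only [hs, if_false]; split_ifs <;> norm_num

lemma bernoulliProb_nonneg {p : ℝ} (hp : 0 ≤ p) (hp1 : p ≤ 1) (J : Finset ι)
    (A : Set (Finset ι)) : 0 ≤ bernoulliProb p J A :=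
  Finset.sum_nonneg fun s _ =>
    mul_nonneg (bernoulliWeight_nonneg hp hp1 J s) (by split_ifs <;> norm_num)

lemma bernoulliProb_insert {p : ℝ} {J : Finset ι} {a : ι} (ha : a ∉ J) (A : Set (Finset ι)) :
    bernoulliProb p (insert a J) A
      = (1 - p) * bernoulliProb p J A + p * bernoulliProb p J {t | insert a t ∈ A} :=
  sum_bernoulliWeight_insert ha _

/-- `v` bounds the weighted one-sided Hamming distances from `s` to `A` inside `J`. -/
def DominatesDistance (J : Finset ι) (A : Set (Finset ι)) (s : Finset ι) (v : ι → ℝ) : Prop :=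
  ∀ α : ι → ℝ, (∀ i, 0 ≤ α i) → ∀ r : ℝ, (∀ t ∈ A, t ⊆ J → r ≤ ∑ i ∈ s \ t, α i) →
    r ≤ ∑ i ∈ J, α i * v i

/-- Hölder's inequality with exponents `1 / θ` and `1 / (1 - θ)`, obtained by applying weighted
AM-GM to each term after normalising both sums. -/
lemma sum_exp_convexComb_le {σ : Type*} (S : Finset σ) (w a b : σ → ℝ) (hw : ∀ s, 0 ≤ w s)
    {x y θ : ℝ} (hx : 0 < x) (hy : 0 < y) (hθ : 0 ≤ θ) (hθ1 : θ ≤ 1)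
    (ha : x * ∑ s ∈ S, w s * Real.exp (a s) ≤ 1) (hb : y * ∑ s ∈ S, w s * Real.exp (b s) ≤ 1) :
    x ^ θ * y ^ (1 - θ) * ∑ s ∈ S, w s * Real.exp (θ * a s + (1 - θ) * b s) ≤ 1 := by
  have h : ∀ s, x ^ θ * y ^ (1 - θ) * Real.exp (θ * a s + (1 - θ) * b s)
      ≤ θ * (x * Real.exp (a s)) + (1 - θ) * (y * Real.exp (b s)) := by
    intro s
    have := Real.geom_mean_le_arith_mean2_weighted hθ (sub_nonneg.2 hθ1)
      (mul_pos hx (Real.exp_pos (a s))).le (mul_pos hy (Real.exp_pos (b s))).le (by ring)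
    refine le_trans (le_of_eq ?_) this
    rw [Real.mul_rpow hx.le (Real.exp_pos _).le, Real.mul_rpow hy.le (Real.exp_pos _).le,
      Real.exp_add, mul_comm θ, mul_comm (1 - θ), Real.exp_mul, Real.exp_mul]
    ring
  calc x ^ θ * y ^ (1 - θ) * ∑ s ∈ S, w s * Real.exp (θ * a s + (1 - θ) * b s)
      = ∑ s ∈ S, w s * (x ^ θ * y ^ (1 - θ) * Real.exp (θ * a s + (1 - θ) * b s)) := by
        rw [Finset.mul_sum]; exact Finset.sum_congr rfl fun s _ => by ring
    _ ≤ ∑ s ∈ S, w s * (θ * (x * Real.exp (a s)) + (1 - θ) * (y * Real.exp (b s))) :=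
        Finset.sum_le_sum fun s _ => mul_le_mul_of_nonneg_left (h s) (hw s)
    _ = θ * (x * ∑ s ∈ S, w s * Real.exp (a s))
          + (1 - θ) * (y * ∑ s ∈ S, w s * Real.exp (b s)) := by
        simp only [Finset.mul_sum, ← Finset.sum_add_distrib]
        exact Finset.sum_congr rfl fun s _ => by ring
    _ ≤ θ * 1 + (1 - θ) * 1 := by
        gcongr
    _ = 1 := by ring

/-- Talagrand's convex distance inequality for Bernoulli random subsets. -/
theorem exists_dominatesDistance {p : ℝ} (hp : 0 ≤ p) (hp1 : p ≤ 1) (J : Finset ι) :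
    ∀ A : Set (Finset ι), 0 < bernoulliProb p J A → ∃ v : Finset ι → ι → ℝ,
      (∀ s ⊆ J, DominatesDistance J A s (v s)) ∧
      bernoulliProb p J A * ∑ s ∈ J.powerset, bernoulliWeight p J s *
        Real.exp ((∑ i ∈ J, v s i ^ 2) / 4) ≤ 1 := by
  induction J using Finset.induction_on with
  | empty =>
    intro A hA
    have hmem : ∅ ∈ A := by
      by_contra h
      simp [bernoulliProb, h] at hA
    refine ⟨fun _ _ => 0, ?_, by
      simp only [bernoulliProb, bernoulliWeight, Finset.powerset_empty, Finset.sum_singleton,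
        Finset.prod_empty, Finset.sum_empty, hmem, if_true]
      norm_num⟩
    intro s hs α hα r hr
    have := hr ∅ hmem le_rfl
    simpa [Finset.subset_empty.1 hs] using this
  | insert a J ha ih =>
    intro A hA
    -- Induction on the last coordinate `a`: `A₁` is the section of `A` over `a` present, `W` the
    -- projection of `A` that forgets `a`.
    set A₁ : Set (Finset ι) := {t | insert a t ∈ A} with hA₁
    set W : Set (Finset ι) := {t | t ∈ A ∨ insert a t ∈ A} with hW
    have hAW : bernoulliProb p J A ≤ bernoulliProb p J W :=
      bernoulliProb_mono hp hp1 J fun t ht => Or.inl ht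
    have hA₁W : bernoulliProb p J A₁ ≤ bernoulliProb p J W :=
      bernoulliProb_mono hp hp1 J fun t ht => Or.inr ht
    have hins := bernoulliProb_insert (p := p) ha A
    have hWpos : 0 < bernoulliProb p J W := by
      have : bernoulliProb p (insert a J) A ≤ bernoulliProb p J W := by
        rw [hins]; nlinarith
      linarith
    obtain ⟨vW, hvW, hvWsum⟩ := ih W hWpos
    set q := bernoulliProb p J A₁ / bernoulliProb p J W with hq
    have hq0 : 0 ≤ q := div_nonneg (bernoulliProb_nonneg hp hp1 J A₁) hWpos.le
    have hq1 : q ≤ 1 := (div_le_one hWpos).2 hA₁W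
    -- Vectors for the sets containing `a`: mix the vector for `A₁`, which costs nothing at `a`,
    -- with the one for `W`, which may cost `1` there. With weights `θ` and `1 - θ` the coordinate
    -- at `a` becomes `1 - θ`.
    obtain ⟨θ, hθ0, hθ1, v', hv', hv'sum⟩ : ∃ θ : ℝ, 0 ≤ θ ∧ θ ≤ 1 ∧ ∃ v' : Finset ι → ι → ℝ,
        (∀ s ⊆ J, ∀ α : ι → ℝ, (∀ i, 0 ≤ α i) → ∀ r : ℝ,
          (∀ t ∈ A, t ⊆ insert a J → r ≤ ∑ i ∈ insert a s \ t, α i) →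
          r ≤ ∑ i ∈ J, α i * v' s i + (1 - θ) * α a) ∧
        bernoulliProb p J W * ∑ s ∈ J.powerset, bernoulliWeight p J s *
          Real.exp ((∑ i ∈ J, v' s i ^ 2) / 4 + (1 - θ) ^ 2 / 4) ≤ 2 - q := by
      have hWdist : ∀ s ⊆ J, ∀ α : ι → ℝ, (∀ i, 0 ≤ α i) → ∀ r : ℝ,
          (∀ t ∈ A, t ⊆ insert a J → r ≤ ∑ i ∈ insert a s \ t, α i) →
          r ≤ ∑ i ∈ J, α i * vW s i + α a := by
        intro s hs α hα r hr
        have has : a ∉ s := fun h => ha (hs h)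
        have := hvW s hs α hα (r - α a) ?_
        · linarith
        intro t ht htJ
        have hat : a ∉ t := fun h => ha (htJ h)
        rcases ht with ht | ht
        · have h1 := hr t ht (htJ.trans (Finset.subset_insert _ _))
          rw [Finset.insert_sdiff_of_notMem _ hat, Finset.sum_insert (by simp [has])] at h1
          linarith
        · have h1 := hr _ ht (Finset.insert_subset_insert _ htJ)
          rw [Finset.insert_sdiff_insert, Finset.sdiff_insert_of_notMem has] at h1
          linarith [hα a]
      -- If `q = 0` the section `A₁` has probability zero and the induction hypothesis is not
      -- available for it; then `θ = 0`, and `e^(1/4) ≤ 2` is all that is needed.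
      rcases hq0.eq_or_lt with hq0 | hq0
      · refine ⟨0, le_rfl, zero_le_one, vW, fun s hs α hα r hr => ?_, ?_⟩
        · simpa using hWdist s hs α hα r hr
        · have e1 : Real.exp (1 / 4) ≤ 2 := by
            have h1 := Real.exp_one_lt_d9
            have h2 : Real.exp (1 / 4) ≤ Real.exp (Real.log 2) :=
              Real.exp_le_exp.2 (by linarith [Real.log_two_gt_d9])
            rwa [Real.exp_log two_pos] at h2
          rw [← hq0]
          simp only [Real.exp_add, ← mul_assoc, ← Finset.sum_mul]
          calc _ ≤ 1 * Real.exp (1 / 4) := by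
                rw [sub_zero, one_pow]
                simpa only [mul_assoc, Finset.mul_sum] using
                  mul_le_mul_of_nonneg_right hvWsum (Real.exp_pos (1 / 4)).le
            _ ≤ _ := by linarith
      · have hA₁pos : 0 < bernoulliProb p J A₁ := by
          by_contra h
          have : bernoulliProb p J A₁ = 0 :=
            le_antisymm (not_lt.1 h) (bernoulliProb_nonneg hp hp1 J A₁)
          simp [hq, this] at hq0
        obtain ⟨v₁, hv₁, hv₁sum⟩ := ih A₁ hA₁pos
        obtain ⟨θ, hθ0, hθ1, hθ⟩ := exists_exp_sq_le_mul_rpow hq0 hq1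
        refine ⟨θ, hθ0, hθ1, fun s i => θ * v₁ s i + (1 - θ) * vW s i, ?_, ?_⟩
        · intro s hs α hα r hr
          have has : a ∉ s := fun h => ha (hs h)
          have h1 := hWdist s hs α hα r hr
          have h2 : r ≤ ∑ i ∈ J, α i * v₁ s i := by
            refine hv₁ s hs α hα r fun t ht htJ => ?_
            have h1 := hr _ ht (Finset.insert_subset_insert _ htJ)
            rwa [Finset.insert_sdiff_insert, Finset.sdiff_insert_of_notMem has] at h1
          have h3 : ∑ i ∈ J, α i * (θ * v₁ s i + (1 - θ) * vW s i)
              = θ * ∑ i ∈ J, α i * v₁ s i + (1 - θ) * ∑ i ∈ J, α i * vW s i := by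
            simp only [Finset.mul_sum, ← Finset.sum_add_distrib]
            exact Finset.sum_congr rfl fun i _ => by ring
          rw [h3]
          nlinarith [mul_le_mul_of_nonneg_left h1 (sub_nonneg.2 hθ1),
            mul_le_mul_of_nonneg_left h2 hθ0]
        · have hconv : ∀ s, (∑ i ∈ J, (θ * v₁ s i + (1 - θ) * vW s i) ^ 2) / 4
              ≤ θ * ((∑ i ∈ J, v₁ s i ^ 2) / 4) + (1 - θ) * ((∑ i ∈ J, vW s i ^ 2) / 4) := by
            intro s
            have : ∑ i ∈ J, (θ * v₁ s i + (1 - θ) * vW s i) ^ 2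
                ≤ ∑ i ∈ J, (θ * v₁ s i ^ 2 + (1 - θ) * vW s i ^ 2) := by
              refine Finset.sum_le_sum fun i _ => ?_
              nlinarith [mul_nonneg (mul_nonneg hθ0 (sub_nonneg.2 hθ1))
                (sq_nonneg (v₁ s i - vW s i))]
            rw [Finset.sum_add_distrib, ← Finset.mul_sum, ← Finset.mul_sum] at this
            linarith
          have hH := sum_exp_convexComb_le J.powerset (bernoulliWeight p J)
            (fun s => (∑ i ∈ J, v₁ s i ^ 2) / 4) (fun s => (∑ i ∈ J, vW s i ^ 2) / 4)
            (bernoulliWeight_nonneg hp hp1 J) hA₁pos hWpos hθ0 hθ1 hv₁sum hvWsum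
          have hpw : bernoulliProb p J A₁ ^ θ * bernoulliProb p J W ^ (1 - θ)
              = q ^ θ * bernoulliProb p J W := by
            rw [hq, Real.div_rpow hA₁pos.le hWpos.le, Real.rpow_sub hWpos, Real.rpow_one]
            ring
          rw [hpw] at hH
          have hle : bernoulliProb p J W * ∑ s ∈ J.powerset, bernoulliWeight p J s *
              Real.exp ((∑ i ∈ J, (θ * v₁ s i + (1 - θ) * vW s i) ^ 2) / 4 + (1 - θ) ^ 2 / 4)
              ≤ bernoulliProb p J W * ∑ s ∈ J.powerset, bernoulliWeight p J s *
              (Real.exp (θ * ((∑ i ∈ J, v₁ s i ^ 2) / 4)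
                + (1 - θ) * ((∑ i ∈ J, vW s i ^ 2) / 4)) * ((2 - q) * q ^ θ)) := by
            refine mul_le_mul_of_nonneg_left (Finset.sum_le_sum fun s _ =>
              mul_le_mul_of_nonneg_left ?_ (bernoulliWeight_nonneg hp hp1 J s)) hWpos.le
            rw [Real.exp_add]
            gcongr
            exact hconv s
          refine hle.trans ?_
          simp only [← mul_assoc, ← Finset.sum_mul]
          nlinarith
    -- For `a ∉ s` the distance is one-sided, so `a` never lies in `s \ t` and the projection `W`
    -- can be used without cost.
    refine ⟨fun s i => if a ∈ s then (if i = a then 1 - θ else v' (s.erase a) i)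
      else (if i = a then 0 else vW s i), ?_, ?_⟩
    · intro s hs α hα r hr
      have hne : ∀ i ∈ J, i ≠ a := fun i hi h => ha (h ▸ hi)
      rw [Finset.sum_insert ha]
      by_cases has : a ∈ s
      · have hsJ : s.erase a ⊆ J := by
          rwa [← Finset.subset_insert_iff]
        have := hv' (s.erase a) hsJ α hα r (by rwa [Finset.insert_erase has])
        simp only [has, if_true]
        rw [Finset.sum_congr rfl fun i hi => by rw [if_neg (hne i hi)]]
        linarith
      · have hsJ : s ⊆ J := (Finset.subset_insert_iff_of_notMem has).1 hs
        simp only [has, if_false, if_true, mul_zero, zero_add]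
        rw [Finset.sum_congr rfl fun i hi => by rw [if_neg (hne i hi)]]
        refine hvW s hsJ α hα r fun t ht htJ => ?_
        rcases ht with ht | ht
        · exact hr t ht (htJ.trans (Finset.subset_insert _ _))
        · have h1 := hr _ ht (Finset.insert_subset_insert _ htJ)
          rwa [Finset.sdiff_insert_of_notMem has] at h1
    · rw [sum_bernoulliWeight_insert ha]
      have hne : ∀ i ∈ J, i ≠ a := fun i hi h => ha (h ▸ hi)
      have e1 : ∑ s ∈ J.powerset, bernoulliWeight p J s *
          Real.exp ((∑ i ∈ insert a J, (if a ∈ s then (if i = a then 1 - θ else v' (s.erase a) i)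
            else (if i = a then 0 else vW s i)) ^ 2) / 4)
          = ∑ s ∈ J.powerset, bernoulliWeight p J s * Real.exp ((∑ i ∈ J, vW s i ^ 2) / 4) := by
        refine Finset.sum_congr rfl fun s hs => ?_
        have has : a ∉ s := fun h => ha (Finset.mem_powerset.1 hs h)
        rw [Finset.sum_insert ha]
        simp only [has, if_false, if_true]
        rw [Finset.sum_congr rfl fun i hi => by rw [if_neg (hne i hi)]]
        simp
      have e2 : ∑ s ∈ J.powerset, bernoulliWeight p J s *
          Real.exp ((∑ i ∈ insert a J, (if a ∈ insert a s then
            (if i = a then 1 - θ else v' ((insert a s).erase a) i)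
            else (if i = a then 0 else vW (insert a s) i)) ^ 2) / 4)
          = ∑ s ∈ J.powerset, bernoulliWeight p J s *
            Real.exp ((∑ i ∈ J, v' s i ^ 2) / 4 + (1 - θ) ^ 2 / 4) := by
        refine Finset.sum_congr rfl fun s hs => ?_
        have has : a ∉ s := fun h => ha (Finset.mem_powerset.1 hs h)
        rw [Finset.sum_insert ha]
        simp only [Finset.mem_insert_self, if_true, Finset.erase_insert has]
        rw [Finset.sum_congr rfl fun i hi => by rw [if_neg (hne i hi)]]
        congr 2
        ring
      rw [e1, e2]
      set SW := ∑ s ∈ J.powerset, bernoulliWeight p J s * Real.exp ((∑ i ∈ J, vW s i ^ 2) / 4)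
      set S' := ∑ s ∈ J.powerset, bernoulliWeight p J s *
            Real.exp ((∑ i ∈ J, v' s i ^ 2) / 4 + (1 - θ) ^ 2 / 4)
      set PW := bernoulliProb p J W
      have hA₁q : bernoulliProb p J A₁ = q * PW := by rw [hq]; field_simp
      have hle : bernoulliProb p (insert a J) A ≤ PW * (1 - p * (1 - q)) := by
        rw [hins, hA₁q]; nlinarith
      have hsum : PW * ((1 - p) * SW + p * S') ≤ 1 + p * (1 - q) := by
        nlinarith [mul_le_mul_of_nonneg_left hvWsum (sub_nonneg.2 hp1),
          mul_le_mul_of_nonneg_left hv'sum hp]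
      have hSnn : 0 ≤ (1 - p) * SW + p * S' := by
        have h1 : 0 ≤ SW := Finset.sum_nonneg fun s _ =>
          mul_nonneg (bernoulliWeight_nonneg hp hp1 J s) (Real.exp_pos _).le
        have h2 : 0 ≤ S' := Finset.sum_nonneg fun s _ =>
          mul_nonneg (bernoulliWeight_nonneg hp hp1 J s) (Real.exp_pos _).le
        have := sub_nonneg.2 hp1
        positivity
      have hx : 0 ≤ 1 - p * (1 - q) := by nlinarith
      -- With `x = p * (1 - q)` the two estimates multiply to `(1 - x) * (1 + x) ≤ 1`.
      calc bernoulliProb p (insert a J) A * ((1 - p) * SW + p * S')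
          ≤ PW * (1 - p * (1 - q)) * ((1 - p) * SW + p * S') := by gcongr
        _ = (1 - p * (1 - q)) * (PW * ((1 - p) * SW + p * S')) := by ring
        _ ≤ (1 - p * (1 - q)) * (1 + p * (1 - q)) := by gcongr
        _ ≤ 1 := by nlinarith [sq_nonneg (p * (1 - q))]

/-- Two families of subsets at convex distance at least `r` cannot both be likely. -/
theorem bernoulliProb_mul_le {p : ℝ} (hp : 0 ≤ p) (hp1 : p ≤ 1) (J : Finset ι)
    (A B : Set (Finset ι)) {r : ℝ} (hr : 0 ≤ r)
    (h : ∀ s ∈ B, s ⊆ J → ∃ α : ι → ℝ, (∀ i, 0 ≤ α i) ∧ ∑ i ∈ J, α i ^ 2 ≤ 1 ∧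
      ∀ t ∈ A, t ⊆ J → r ≤ ∑ i ∈ s \ t, α i) :
    bernoulliProb p J A * bernoulliProb p J B ≤ Real.exp (-(r ^ 2 / 4)) := by
  rcases (bernoulliProb_nonneg hp hp1 J A).eq_or_lt with h0 | hpos
  · rw [← h0, zero_mul]; exact (Real.exp_pos _).le
  obtain ⟨v, hv, hsum⟩ := exists_dominatesDistance hp hp1 J A hpos
  -- Markov's inequality for the exponential moment; on `B`, Cauchy–Schwarz turns the weights `α`
  -- into `r ^ 2 ≤ ∑ v ^ 2`.
  have hB : bernoulliProb p J B * Real.exp (r ^ 2 / 4)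
      ≤ ∑ s ∈ J.powerset, bernoulliWeight p J s * Real.exp ((∑ i ∈ J, v s i ^ 2) / 4) := by
    unfold bernoulliProb
    rw [Finset.sum_mul]
    refine Finset.sum_le_sum fun s hs => ?_
    rw [mul_assoc]
    refine mul_le_mul_of_nonneg_left ?_ (bernoulliWeight_nonneg hp hp1 J s)
    by_cases hsB : s ∈ B
    · simp only [hsB, if_true, one_mul]
      apply Real.exp_le_exp.2
      obtain ⟨α, hα, hα1, hαr⟩ := h s hsB (Finset.mem_powerset.1 hs)
      have h1 := hv s (Finset.mem_powerset.1 hs) α hα r hαr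
      have h2 := Finset.sum_mul_sq_le_sq_mul_sq J α (v s)
      have h3 : r ^ 2 ≤ (∑ i ∈ J, α i * v s i) ^ 2 := by gcongr
      have h4 : 0 ≤ ∑ i ∈ J, v s i ^ 2 := Finset.sum_nonneg fun i _ => sq_nonneg _
      nlinarith [mul_le_mul_of_nonneg_right hα1 h4]
    · simp only [hsB, if_false, zero_mul]; exact (Real.exp_pos _).le
  rw [Real.exp_neg, ← one_div, le_div_iff₀ (Real.exp_pos _), mul_assoc]
  exact (mul_le_mul_of_nonneg_left hB hpos.le).trans hsum

end Talagrand

/-! ### From Bernoulli subsets to samples of Poisson size. -/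

section PoissonSample
open Filter Topology
open scoped NNReal Nat
variable {X : Type*} [MeasurableSpace X]

/-- Finite ordered samples of points of `X`. -/
abbrev FiniteSample (X : Type*) := Σ n : ℕ, Fin n → X

/-- The sample with the `n` points `x`. -/
def FiniteSample.mk {X : Type*} (n : ℕ) (x : Fin n → X) : FiniteSample X := ⟨n, x⟩

/-- The law of a sample from `ρ` of Poisson distributed size. -/
noncomputable def poissonSampleLaw (r : ℝ≥0) (ρ : Measure X) : Measure (FiniteSample X) :=
  Measure.sum fun n => poissonMeasure r {n} • (Measure.pi fun _ : Fin n => ρ).map (FiniteSample.mk n)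

lemma measurable_finiteSampleMk (n : ℕ) :
    Measurable (FiniteSample.mk n : (Fin n → X) → FiniteSample X) :=
  fun _ hs => MeasurableSpace.measurableSet_iInf.1 hs n

lemma measurableSet_finiteSample_iff {A : Set (FiniteSample X)} :
    MeasurableSet A ↔ ∀ n, MeasurableSet (FiniteSample.mk n ⁻¹' A) :=
  MeasurableSpace.measurableSet_iInf

lemma poissonSampleLaw_apply (r : ℝ≥0) (ρ : Measure X) {A : Set (FiniteSample X)}
    (hA : MeasurableSet A) :
    poissonSampleLaw r ρ A
      = ∑' n, poissonMeasure r {n} * (Measure.pi fun _ : Fin n => ρ) (FiniteSample.mk n ⁻¹' A) := by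
  rw [poissonSampleLaw, Measure.sum_apply _ hA]
  refine tsum_congr fun n => ?_
  rw [Measure.smul_apply, Measure.map_apply (measurable_finiteSampleMk n) hA, smul_eq_mul]

instance isProbabilityMeasure_poissonSampleLaw (r : ℝ≥0) (ρ : Measure X)
    [IsProbabilityMeasure ρ] : IsProbabilityMeasure (poissonSampleLaw r ρ) := by
  constructor
  rw [poissonSampleLaw_apply r ρ .univ]
  simp only [Set.preimage_univ, measure_univ, mul_one, poissonMeasure_singleton]
  rw [← ENNReal.ofReal_tsum_of_nonneg (fun n => by positivity)
    (hasSum_one_poissonMeasure r).summable, (hasSum_one_poissonMeasure r).tsum_eq,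
    ENNReal.ofReal_one]

lemma hasSum_poissonSampleLaw (r : ℝ≥0) (ρ : Measure X) [IsProbabilityMeasure ρ]
    {A : Set (FiniteSample X)} (hA : MeasurableSet A) :
    HasSum (fun n : ℕ => Real.exp (-r) * r ^ n / n ! *
      (Measure.pi fun _ : Fin n => ρ).real (FiniteSample.mk n ⁻¹' A))
      ((poissonSampleLaw r ρ).real A) := by
  have hnn : ∀ n : ℕ, 0 ≤ Real.exp (-r) * r ^ n / n ! *
      (Measure.pi fun _ : Fin n => ρ).real (FiniteSample.mk n ⁻¹' A) := fun n => by positivity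
  have hs : Summable (fun n : ℕ => Real.exp (-r) * r ^ n / n ! *
      (Measure.pi fun _ : Fin n => ρ).real (FiniteSample.mk n ⁻¹' A)) := by
    refine Summable.of_nonneg_of_le hnn (fun n => ?_) (hasSum_one_poissonMeasure r).summable
    exact mul_le_of_le_one_right (by positivity) measureReal_le_one
  convert hs.hasSum
  rw [measureReal_def, poissonSampleLaw_apply r ρ hA]
  rw [← ENNReal.toReal_ofReal (tsum_nonneg hnn), ENNReal.ofReal_tsum_of_nonneg hnn hs]
  congr 1
  refine tsum_congr fun n => ?_
  rw [ENNReal.ofReal_mul (by positivity), poissonMeasure_singleton, measureReal_def,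
    ENNReal.ofReal_toReal (measure_ne_top _ _)]

/-- The subsample of `Y` with index set `S`. -/
def subsample {L : ℕ} (Y : Fin L → X) (S : Finset (Fin L)) : FiniteSample X :=
  ⟨S.card, fun i => Y (S.orderEmbOfFin rfl i)⟩

lemma measurable_subsample {L : ℕ} (S : Finset (Fin L)) :
    Measurable fun Y : Fin L → X => subsample Y S :=
  (measurable_finiteSampleMk S.card).comp (measurable_pi_lambda _ fun _ => measurable_pi_apply _)

lemma map_comp_pi_of_injective {ι κ : Type*} [Fintype ι] [Fintype κ] (ρ : Measure X)
    [IsProbabilityMeasure ρ] {e : κ → ι} (he : Function.Injective e) :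
    (Measure.pi fun _ : ι => ρ).map (fun Y : ι → X => Y ∘ e) = Measure.pi fun _ : κ => ρ := by
  have h : iIndepFun (fun (i : ι) (Y : ι → X) => Y i) (Measure.pi fun _ : ι => ρ) :=
    iIndepFun_pi (X := fun _ x => x) fun _ => aemeasurable_id
  have h2 := (iIndepFun_iff_map_fun_eq_pi_map
    (fun i => (measurable_pi_apply (e i)).aemeasurable)).1 (h.precomp he)
  rw [show (fun Y : ι → X => Y ∘ e) = fun Y i => Y (e i) from rfl, h2]
  congr 1
  ext1 i
  exact (measurePreserving_eval (fun _ : ι => ρ) (e i)).map_eq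

lemma measureReal_subsample {L : ℕ} (ρ : Measure X) [IsProbabilityMeasure ρ]
    (S : Finset (Fin L)) {A : Set (FiniteSample X)} (hA : MeasurableSet A) :
    (Measure.pi fun _ : Fin L => ρ).real {Y | subsample Y S ∈ A}
      = (Measure.pi fun _ : Fin S.card => ρ).real (FiniteSample.mk S.card ⁻¹' A) := by
  have h := map_comp_pi_of_injective ρ (S.orderEmbOfFin rfl).injective
  have hm : Measurable fun Y : Fin L → X => Y ∘ S.orderEmbOfFin rfl :=
    measurable_pi_lambda _ fun _ => measurable_pi_apply _
  rw [← h, map_measureReal_apply hm (measurable_finiteSampleMk _ hA)]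
  rfl

lemma measureReal_subsample_inter {L : ℕ} (ρ : Measure X) [IsProbabilityMeasure ρ]
    {S T : Finset (Fin L)} (hST : Disjoint S T) {A B : Set (FiniteSample X)}
    (hA : MeasurableSet A) (hB : MeasurableSet B) :
    (Measure.pi fun _ : Fin L => ρ).real ({Y | subsample Y S ∈ A} ∩ {Y | subsample Y T ∈ B})
      = (Measure.pi fun _ : Fin S.card => ρ).real (FiniteSample.mk S.card ⁻¹' A)
        * (Measure.pi fun _ : Fin T.card => ρ).real (FiniteSample.mk T.card ⁻¹' B) := by
  have h : iIndepFun (fun (i : Fin L) (Y : Fin L → X) => Y i) (Measure.pi fun _ : Fin L => ρ) :=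
    iIndepFun_pi (X := fun _ x => x) fun _ => aemeasurable_id
  have h2 := h.indepFun_finset S T hST fun i => measurable_pi_apply i
  have hr : ∀ S : Finset (Fin L), Measurable fun z : S → X =>
      (⟨S.card, fun i => z ⟨S.orderEmbOfFin rfl i, S.orderEmbOfFin_mem rfl i⟩⟩ :
        FiniteSample X) := fun S =>
    (measurable_finiteSampleMk S.card).comp (measurable_pi_lambda _ fun _ => measurable_pi_apply _)
  have h3 := h2.comp (hr S) (hr T)
  have h4 := h3.measure_inter_preimage_eq_mul A B hA hB
  rw [← measureReal_subsample ρ S hA, ← measureReal_subsample ρ T hB]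
  simp only [measureReal_def, ← ENNReal.toReal_mul]
  exact congrArg _ h4

lemma bernoulliWeight_univ {L : ℕ} (p : ℝ) (S : Finset (Fin L)) :
    bernoulliWeight p Finset.univ S = p ^ S.card * (1 - p) ^ (L - S.card) := by
  rw [bernoulliWeight, Finset.prod_ite, Finset.prod_const, Finset.prod_const]
  congr 2
  · simp
  · rw [Finset.filter_not, Finset.card_univ_sdiff]; simp

/-- For fixed `Y` the cube inequality bounds the product of the probabilities that two independent
Bernoulli(`p`) subsamples fall in `B` and in `A`. Averaging over `Y` factorises only for disjoint
index sets, where the subsamples are independent; the other pairs have nonnegative weight and are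
discarded. -/
lemma sum_binomial_mul_le {p : ℝ} (hp : 0 ≤ p) (hp1 : p ≤ 1) (L : ℕ) (ρ : Measure X)
    [IsProbabilityMeasure ρ] {A B : Set (FiniteSample X)} (hA : MeasurableSet A)
    (hB : MeasurableSet B) {r : ℝ} (hr : 0 ≤ r)
    (h : ∀ᵐ Y ∂(Measure.pi fun _ : Fin L => ρ), ∀ S, subsample Y S ∈ B →
      ∃ α : Fin L → ℝ, (∀ i, 0 ≤ α i) ∧ ∑ i, α i ^ 2 ≤ 1 ∧
        ∀ T, subsample Y T ∈ A → r ≤ ∑ i ∈ S \ T, α i) :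
    ∑ n ∈ Finset.range (L + 1), (L.choose n : ℝ) * ∑ m ∈ Finset.range (L - n + 1),
      ((L - n).choose m : ℝ) * ((p ^ n * (1 - p) ^ (L - n) *
        (Measure.pi fun _ : Fin n => ρ).real (FiniteSample.mk n ⁻¹' B)) *
        (p ^ m * (1 - p) ^ (L - m) * (Measure.pi fun _ : Fin m => ρ).real (FiniteSample.mk m ⁻¹' A)))
      ≤ Real.exp (-(r ^ 2 / 4)) := by
  classical
  set w := bernoulliWeight p (Finset.univ : Finset (Fin L)) with hw
  have hw0 : ∀ S, 0 ≤ w S := bernoulliWeight_nonneg hp hp1 _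
  set E : Finset (Fin L) → Finset (Fin L) → Set (Fin L → X) := fun S T =>
    {Y | subsample Y S ∈ B} ∩ {Y | subsample Y T ∈ A} with hE
  have hEm : ∀ S T, MeasurableSet (E S T) := fun S T =>
    (measurable_subsample S hB).inter (measurable_subsample T hA)
  -- Restricting `T` to subsets of `Sᶜ` is the discarding of overlapping pairs.
  set g : (Fin L → X) → ℝ := fun Y => ∑ S ∈ Finset.univ.powerset, ∑ T ∈ (Sᶜ).powerset,
    (w S * w T) * (E S T).indicator (fun _ => 1) Y with hg
  have hgle : ∀ᵐ Y ∂(Measure.pi fun _ : Fin L => ρ), g Y ≤ Real.exp (-(r ^ 2 / 4)) := by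
    filter_upwards [h] with Y hY
    refine le_trans ?_ (bernoulliProb_mul_le hp hp1 Finset.univ {T | subsample Y T ∈ A}
      {S | subsample Y S ∈ B} hr fun S hS _ => ?_)
    · rw [mul_comm, bernoulliProb, bernoulliProb, Finset.sum_mul]
      refine Finset.sum_le_sum fun S _ => ?_
      rw [Finset.mul_sum]
      refine (Finset.sum_le_sum_of_subset_of_nonneg
        (Finset.powerset_mono.2 (Finset.subset_univ _)) fun T _ _ => ?_).trans
        (le_of_eq (Finset.sum_congr rfl fun T _ => ?_))
      · exact mul_nonneg (mul_nonneg (hw0 S) (hw0 T))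
          (Set.indicator_nonneg (fun _ _ => zero_le_one) _)
      · by_cases h1 : subsample Y S ∈ B <;> by_cases h2 : subsample Y T ∈ A <;>
          simp [hE, h1, h2, hw]
    · obtain ⟨α, h1, h2, h3⟩ := hY S hS
      exact ⟨α, h1, h2, fun T hT _ => h3 T hT⟩
  have hint : ∀ S T, Integrable (fun Y => (w S * w T) * (E S T).indicator (fun _ => (1 : ℝ)) Y)
      (Measure.pi fun _ : Fin L => ρ) := fun S T =>
    ((integrable_const 1).indicator (hEm S T)).const_mul _
  have hgint : Integrable g (Measure.pi fun _ : Fin L => ρ) :=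
    integrable_finsetSum _ fun S _ => integrable_finsetSum _ fun T _ => hint S T
  have hint_le := integral_mono_ae hgint (integrable_const _) hgle
  rw [integral_const, probReal_univ, one_smul] at hint_le
  refine le_trans (le_of_eq ?_) hint_le
  rw [hg, integral_finsetSum _ fun S _ => integrable_finsetSum _ fun T _ => hint S T]
  set b : ℕ → ℝ := fun n => (Measure.pi fun _ : Fin n => ρ).real (FiniteSample.mk n ⁻¹' B) with hb
  set a : ℕ → ℝ := fun n => (Measure.pi fun _ : Fin n => ρ).real (FiniteSample.mk n ⁻¹' A) with ha
  have hterm : ∀ S ∈ (Finset.univ : Finset (Fin L)).powerset,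
      ∫ Y, ∑ T ∈ (Sᶜ).powerset, (w S * w T) * (E S T).indicator (fun _ => (1 : ℝ)) Y
        ∂(Measure.pi fun _ : Fin L => ρ)
      = ∑ m ∈ Finset.range (L - S.card + 1), ((L - S.card).choose m : ℝ) *
        ((p ^ S.card * (1 - p) ^ (L - S.card) * b S.card) * (p ^ m * (1 - p) ^ (L - m) * a m)) := by
    intro S _
    rw [integral_finsetSum _ fun T _ => hint S T]
    have := Finset.sum_powerset_apply_card (fun m => (p ^ S.card * (1 - p) ^ (L - S.card)
      * b S.card) * (p ^ m * (1 - p) ^ (L - m) * a m)) (x := Sᶜ)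
    rw [Finset.card_compl, Fintype.card_fin] at this
    simp only [nsmul_eq_mul] at this
    rw [← this]
    refine Finset.sum_congr rfl fun T hT => ?_
    have hdisj : Disjoint S T :=
      (Finset.subset_compl_iff_disjoint_left.1 (Finset.mem_powerset.1 hT))
    rw [integral_const_mul, integral_indicator_const _ (hEm S T),
      measureReal_subsample_inter ρ hdisj hB hA, hw, bernoulliWeight_univ, bernoulliWeight_univ,
      smul_eq_mul]
    ring
  rw [Finset.sum_congr rfl hterm]
  have := Finset.sum_powerset_apply_card (fun n => ∑ m ∈ Finset.range (L - n + 1),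
    ((L - n).choose m : ℝ) * ((p ^ n * (1 - p) ^ (L - n) * b n) *
      (p ^ m * (1 - p) ^ (L - m) * a m))) (x := (Finset.univ : Finset (Fin L)))
  rw [Finset.card_univ, Fintype.card_fin] at this
  simp only [nsmul_eq_mul] at this
  rw [this]

/-- The law of rare events; the shift by `n` comes from the `n` indices already used by the first
subsample and is invisible in the limit. -/
lemma tendsto_choose_sub_mul_pow (r : ℝ) (n m : ℕ) :
    Tendsto (fun L : ℕ => ((L - n).choose m : ℝ) * ((r / L) ^ m * (1 - r / L) ^ (L - m)))
      atTop (𝓝 (Real.exp (-r) * r ^ m / m !)) := by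
  have hp : Tendsto (fun N : ℕ => (N : ℝ) * (r / ((N + n : ℕ) : ℝ))) atTop (𝓝 r) := by
    have h1 : Tendsto (fun N : ℕ => r - r * n / ((N + n : ℕ) : ℝ)) atTop (𝓝 (r - 0)) :=
      tendsto_const_nhds.sub (tendsto_const_nhds.div_atTop
        (tendsto_natCast_atTop_atTop.comp (tendsto_add_atTop_nat n)))
    rw [sub_zero] at h1
    refine h1.congr' ?_
    filter_upwards [eventually_ge_atTop 1] with N hN
    have : ((N + n : ℕ) : ℝ) ≠ 0 := by positivity
    field_simp
    push_cast
    ring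
  have h1 := tendsto_choose_mul_pow_of_tendsto_mul_atTop m hp
  have h2 : Tendsto (fun N : ℕ => (1 - r / ((N + n : ℕ) : ℝ)) ^ n) atTop (𝓝 1) := by
    have := (tendsto_const_nhds (x := (1 : ℝ))).sub (tendsto_zero_of_tendsto_mul_atTop hp)
    simpa using this.pow n
  have h3 := h1.mul h2
  rw [mul_one] at h3
  refine (h3.comp (tendsto_sub_atTop_nat n)).congr' ?_
  filter_upwards [eventually_ge_atTop (n + m)] with L hL
  have e1 : L - n + n = L := by omega
  have e2 : L - m = (L - n - m) + n := by omega
  simp only [Function.comp, e1]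
  rw [e2, pow_add]
  ring

/-- The convex distance inequality for samples of Poisson distributed size. -/
theorem poissonSampleLaw_mul_le (r : ℝ≥0) (ρ : Measure X) [IsProbabilityMeasure ρ]
    {A B : Set (FiniteSample X)} (hA : MeasurableSet A) (hB : MeasurableSet B)
    {d : ℝ} (hd : 0 ≤ d)
    (h : ∀ L, ∀ᵐ Y ∂(Measure.pi fun _ : Fin L => ρ), ∀ S, subsample Y S ∈ B →
      ∃ α : Fin L → ℝ, (∀ i, 0 ≤ α i) ∧ ∑ i, α i ^ 2 ≤ 1 ∧
        ∀ T, subsample Y T ∈ A → d ≤ ∑ i ∈ S \ T, α i) :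
    (poissonSampleLaw r ρ).real A * (poissonSampleLaw r ρ).real B
      ≤ Real.exp (-(d ^ 2 / 4)) := by
  set b : ℕ → ℝ := fun n => (Measure.pi fun _ : Fin n => ρ).real (FiniteSample.mk n ⁻¹' B) with hb
  set a : ℕ → ℝ := fun n => (Measure.pi fun _ : Fin n => ρ).real (FiniteSample.mk n ⁻¹' A) with ha
  have hb0 : ∀ n, 0 ≤ b n := fun n => measureReal_nonneg
  have ha0 : ∀ n, 0 ≤ a n := fun n => measureReal_nonneg
  -- Truncating both sizes at `K` leaves finite sums, for which the termwise limit `L → ∞` is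
  -- immediate; `K → ∞` comes last.
  have hK : ∀ K : ℕ, (∑ m ∈ Finset.range K, Real.exp (-r) * r ^ m / m ! * a m) *
      (∑ n ∈ Finset.range K, Real.exp (-r) * r ^ n / n ! * b n) ≤ Real.exp (-(d ^ 2 / 4)) := by
    intro K
    have hlim : Tendsto (fun L : ℕ => ∑ n ∈ Finset.range K, ∑ m ∈ Finset.range K,
        (((L - 0).choose n : ℝ) * (((r : ℝ) / L) ^ n * (1 - (r : ℝ) / L) ^ (L - n)) * b n) *
        (((L - n).choose m : ℝ) * (((r : ℝ) / L) ^ m * (1 - (r : ℝ) / L) ^ (L - m)) * a m))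
        atTop (𝓝 (∑ n ∈ Finset.range K, ∑ m ∈ Finset.range K,
          (Real.exp (-r) * r ^ n / n ! * b n) * (Real.exp (-r) * r ^ m / m ! * a m))) := by
      refine tendsto_finsetSum _ fun n _ => tendsto_finsetSum _ fun m _ => ?_
      exact ((tendsto_choose_sub_mul_pow r 0 n).mul_const _).mul
        ((tendsto_choose_sub_mul_pow r n m).mul_const _)
    rw [mul_comm, Finset.sum_mul_sum]
    refine le_of_tendsto hlim ?_
    obtain ⟨R, hR⟩ := exists_nat_ge (r : ℝ)
    filter_upwards [eventually_ge_atTop (2 * K + R + 1)] with L hL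
    have hL0 : (0 : ℝ) < L := by
      have : 0 < L := by omega
      exact_mod_cast this
    have hp : (0 : ℝ) ≤ r / L := by positivity
    have hp1 : (r : ℝ) / L ≤ 1 := by
      rw [div_le_one hL0]
      refine hR.trans ?_
      exact_mod_cast (by omega : R ≤ L)
    have hp2 : (0 : ℝ) ≤ 1 - r / L := by linarith
    refine le_trans ?_ (sum_binomial_mul_le hp hp1 L ρ hA hB hd (h L))
    refine le_trans ?_ (Finset.sum_le_sum_of_subset_of_nonneg
      (Finset.range_mono (by omega : K ≤ L + 1)) fun n _ _ => ?_)
    · refine Finset.sum_le_sum fun n hn => ?_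
      rw [Finset.mul_sum]
      refine le_trans ?_ (Finset.sum_le_sum_of_subset_of_nonneg
        (Finset.range_mono (by have := Finset.mem_range.1 hn; omega : K ≤ L - n + 1))
        fun m _ _ => ?_)
      · refine Finset.sum_le_sum fun m _ => le_of_eq ?_
        rw [Nat.sub_zero]
        ring
      · have := hb0 n
        have := ha0 m
        positivity
    · refine mul_nonneg (by positivity) (Finset.sum_nonneg fun m _ => ?_)
      have := hb0 n
      have := ha0 m
      positivity
  exact le_of_tendsto ((hasSum_poissonSampleLaw r ρ hA).tendsto_sum_nat.mul
    (hasSum_poissonSampleLaw r ρ hB).tendsto_sum_nat) (Eventually.of_forall hK)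

end PoissonSample

/-! ### Deterministic estimates for local sums over tuples. -/

section Combinatorics
variable {ι : Type*} [Fintype ι] [DecidableEq ι] {k : ℕ}

/-- The injective `k`-tuples with entries in `S`. -/
def injTuples (k : ℕ) (S : Finset ι) : Finset (Fin k → ι) :=
  Finset.univ.filter fun I => Function.Injective I ∧ ∀ a, I a ∈ S

/-- The part of the sum over `injTuples k S` that involves the index `i`. -/
def localSum (g : (Fin k → ι) → ℝ) (S : Finset ι) (i : ι) : ℝ :=
  ∑ I ∈ injTuples k S, if ∃ a, I a = i then g I else 0

lemma mem_injTuples {S : Finset ι} {I : Fin k → ι} :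
    I ∈ injTuples k S ↔ Function.Injective I ∧ ∀ a, I a ∈ S := by
  simp [injTuples]

lemma localSum_nonneg {g : (Fin k → ι) → ℝ} (hg : ∀ I, 0 ≤ g I) (S : Finset ι) (i : ι) :
    0 ≤ localSum g S i :=
  Finset.sum_nonneg fun I _ => by split_ifs; exacts [hg I, le_rfl]

lemma sum_localSum (g : (Fin k → ι) → ℝ) (S : Finset ι) :
    ∑ i, localSum g S i = k * ∑ I ∈ injTuples k S, g I := by
  unfold localSum
  rw [Finset.sum_comm, Finset.mul_sum]
  refine Finset.sum_congr rfl fun I hI => ?_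
  rw [← Finset.sum_filter, Finset.sum_const, nsmul_eq_mul]
  congr 2
  have : Finset.univ.filter (fun i => ∃ a, I a = i) = Finset.univ.image I := by
    ext i; simp
  rw [this, Finset.card_image_of_injective _ (mem_injTuples.1 hI).1, Finset.card_fin]

/-- A tuple of `S` that is not a tuple of `T` has an entry in `S \ T`, so it is counted in at least
one of the local sums there. -/
lemma sum_injTuples_le_add (g : (Fin k → ι) → ℝ) (hg : ∀ I, 0 ≤ g I) (S T : Finset ι) :
    ∑ I ∈ injTuples k S, g I ≤ ∑ I ∈ injTuples k T, g I + ∑ i ∈ S \ T, localSum g S i := by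
  rw [← Finset.sum_filter_add_sum_filter_not (injTuples k S) (· ∈ injTuples k T)]
  refine add_le_add (Finset.sum_le_sum_of_subset_of_nonneg
    (fun I hI => (Finset.mem_filter.1 hI).2) fun I _ _ => hg I) ?_
  unfold localSum
  rw [Finset.sum_comm, Finset.sum_filter]
  refine Finset.sum_le_sum fun I hI => ?_
  have hnn : ∀ i ∈ S \ T, 0 ≤ if ∃ a, I a = i then g I else 0 := fun i _ => by
    split_ifs; exacts [hg I, le_rfl]
  split_ifs with h
  · exact Finset.sum_nonneg hnn
  · have hI' := mem_injTuples.1 hI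
    obtain ⟨a, ha⟩ : ∃ a, I a ∉ T := by
      by_contra hc
      push Not at hc
      exact h (mem_injTuples.2 ⟨hI'.1, hc⟩)
    refine le_trans (le_of_eq ?_) (Finset.single_le_sum hnn
      (Finset.mem_sdiff.2 ⟨hI'.2 a, ha⟩))
    simp

/-- The index `i` can occupy `k` positions; by locality each of the other `k - 1` entries is one of
at most `Q` neighbours of `i`, and every term is at most `c`. -/
lemma localSum_le {g : (Fin k → ι) → ℝ} {c Q : ℝ} (hc : 0 ≤ c) (hQ : 0 ≤ Q) (hg : ∀ I, 0 ≤ g I)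
    (hgc : ∀ I, Function.Injective I → g I ≤ c)
    (R : ι → ι → Prop) [DecidableRel R] (hR : ∀ I, g I ≠ 0 → ∀ a b, R (I a) (I b))
    (S : Finset ι) (hcount : ∀ i ∈ S, (((S.erase i).filter (R i)).card : ℝ) ≤ Q) (i : ι) :
    localSum g S i ≤ k * (c * Q ^ (k - 1)) := by
  by_cases hiS : i ∈ S
  swap
  · rw [localSum, Finset.sum_eq_zero fun I hI => ?_]
    · positivity
    · rw [if_neg]
      rintro ⟨a, rfl⟩
      exact hiS ((mem_injTuples.1 hI).2 a)
  set N := (S.erase i).filter (R i) with hN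
  have hle : localSum g S i ≤ ∑ a : Fin k, ∑ I ∈ injTuples k S,
      if I a = i then g I else 0 := by
    rw [localSum, Finset.sum_comm]
    refine Finset.sum_le_sum fun I _ => ?_
    have hnn : ∀ a ∈ (Finset.univ : Finset (Fin k)), 0 ≤ if I a = i then g I else 0 :=
      fun a _ => by split_ifs; exacts [hg I, le_rfl]
    split_ifs with h
    · obtain ⟨a, ha⟩ := h
      refine le_trans (le_of_eq ?_) (Finset.single_le_sum hnn (Finset.mem_univ a))
      simp [ha]
    · exact Finset.sum_nonneg hnn
  refine hle.trans ?_
  have hterm : ∀ a : Fin k, (∑ I ∈ injTuples k S, if I a = i then g I else 0)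
      ≤ c * Q ^ (k - 1) := by
    intro a
    set G := (injTuples k S).filter fun I => I a = i ∧ g I ≠ 0 with hG
    have h1 : (∑ I ∈ injTuples k S, if I a = i then g I else 0) = ∑ I ∈ G, g I := by
      rw [hG, Finset.sum_filter]
      refine Finset.sum_congr rfl fun I _ => ?_
      by_cases h : I a = i <;> by_cases h' : g I = 0 <;> simp [h, h']
    have h2 : G.card ≤ N.card ^ (k - 1) := by
      have hcard : (Fintype.piFinset fun _ : {b : Fin k // b ≠ a} => N).card
          = N.card ^ (k - 1) := by
        rw [Fintype.card_piFinset, Finset.prod_const, Finset.card_univ, Fintype.card_subtype_compl,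
          Fintype.card_fin, Fintype.card_subtype_eq]
      rw [← hcard]
      refine Finset.card_le_card_of_injOn (fun I b => I b) (fun I hI => ?_) fun I hI I' hI' h => ?_
      · obtain ⟨hI, hIa, hI0⟩ := Finset.mem_filter.1 hI
        have hI := mem_injTuples.1 hI
        refine Fintype.mem_piFinset.2 fun b => ?_
        refine Finset.mem_filter.2 ⟨Finset.mem_erase.2 ⟨fun h => b.2 (hI.1 (h.trans hIa.symm)),
          hI.2 b⟩, ?_⟩
        have := hR I hI0 a b
        rwa [hIa] at this
      · obtain ⟨-, hIa, -⟩ := Finset.mem_filter.1 hI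
        obtain ⟨-, hIa', -⟩ := Finset.mem_filter.1 hI'
        funext b
        by_cases hb : b = a
        · rw [hb, hIa, hIa']
        · exact congrFun h ⟨b, hb⟩
    have h3 : (N.card : ℝ) ≤ Q := hcount i hiS
    calc (∑ I ∈ injTuples k S, if I a = i then g I else 0) = ∑ I ∈ G, g I := h1
      _ ≤ ∑ I ∈ G, c := Finset.sum_le_sum fun I hI =>
          hgc I (mem_injTuples.1 (Finset.mem_filter.1 hI).1).1
      _ = c * G.card := by rw [Finset.sum_const, nsmul_eq_mul, mul_comm]
      _ ≤ c * (N.card : ℝ) ^ (k - 1) := by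
          gcongr
          exact_mod_cast h2
      _ ≤ c * Q ^ (k - 1) := by gcongr
  refine (Finset.sum_le_sum fun a _ => hterm a).trans (le_of_eq ?_)
  simp

/-- The normalised local sums witness the distance between `S` and the sublevel set of the
`U`-statistic at level `a`. -/
theorem exists_weights_of_localSum {g : (Fin k → ι) → ℝ} {c Q a : ℝ} (hk : 1 ≤ k) (hc : 0 < c)
    (hQ : 0 < Q) (hg : ∀ I, 0 ≤ g I) (hgc : ∀ I, Function.Injective I → g I ≤ c)
    (R : ι → ι → Prop) [DecidableRel R] (hR : ∀ I, g I ≠ 0 → ∀ a b, R (I a) (I b))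
    (S : Finset ι) (hcount : ∀ i ∈ S, (((S.erase i).filter (R i)).card : ℝ) ≤ Q)
    (hpos : 0 < ∑ I ∈ injTuples k S, g I) (ha : a ≤ ∑ I ∈ injTuples k S, g I)
    (hU : c * Q ^ k * ∑ I ∈ injTuples k S, g I ≤ (∑ I ∈ injTuples k S, g I - a) ^ 2) :
    ∃ α : ι → ℝ, (∀ i, 0 ≤ α i) ∧ ∑ i, α i ^ 2 ≤ 1 ∧
      ∀ T, ∑ I ∈ injTuples k T, g I ≤ a → √Q / k ≤ ∑ i ∈ S \ T, α i := by
  set U := ∑ I ∈ injTuples k S, g I with hUdef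
  have hk0 : (0 : ℝ) < k := by exact_mod_cast hk
  set D := (k : ℝ) ^ 2 * (c * Q ^ (k - 1)) * U with hD
  have hD0 : 0 < D := by positivity
  have hs : 0 < √D := Real.sqrt_pos.2 hD0
  -- Here `D` is the largest possible local sum `k * c * Q ^ (k - 1)` times the total `k * U` of all
  -- local sums, hence a bound for the sum of their squares.
  refine ⟨fun i => localSum g S i / √D, fun i => div_nonneg (localSum_nonneg hg S i) hs.le, ?_, ?_⟩
  · simp only [div_pow, Real.sq_sqrt hD0.le]
    rw [← Finset.sum_div, div_le_one hD0]
    calc ∑ i, localSum g S i ^ 2 ≤ ∑ i, (k * (c * Q ^ (k - 1))) * localSum g S i := by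
          refine Finset.sum_le_sum fun i _ => ?_
          rw [sq]
          exact mul_le_mul_of_nonneg_right (localSum_le hc.le hQ.le hg hgc R hR S hcount i)
            (localSum_nonneg hg S i)
      _ = D := by rw [← Finset.mul_sum, sum_localSum, hD]; ring
  · intro T hT
    rw [← Finset.sum_div, le_div_iff₀ hs]
    have h1 := sum_injTuples_le_add g hg S T
    have h2 : √Q / k * √D = √(c * Q ^ k * U) := by
      have e1 : √D = k * √(c * Q ^ (k - 1) * U) := by
        rw [hD, mul_assoc, Real.sqrt_mul (by positivity), Real.sqrt_sq hk0.le]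
      have e2 : c * Q ^ k * U = Q * (c * Q ^ (k - 1) * U) := by
        rw [← Nat.sub_add_cancel hk, pow_succ]
        simp only [Nat.add_sub_cancel]
        ring
      rw [e1, e2, Real.sqrt_mul hQ.le]
      field_simp
    rw [h2]
    refine (Real.sqrt_le_iff.2 ⟨by linarith, hU⟩).trans ?_
    linarith

end Combinatorics

/-! ### U-statistics of ordered samples. -/

section SampleUStatistic
variable {X : Type*} {k : ℕ}

/-- The `U`-statistic of an ordered sample. -/
noncomputable def sampleUStatistic (f : (Fin k → X) → ℝ) (z : FiniteSample X) : ℝ :=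
  ∑ I : Fin k ↪ Fin z.1, f (z.2 ∘ I)

lemma sampleUStatistic_subsample (f : (Fin k → X) → ℝ) {L : ℕ} (Y : Fin L → X)
    (S : Finset (Fin L)) :
    sampleUStatistic f (subsample Y S) = ∑ I ∈ injTuples k S, f (Y ∘ I) := by
  unfold sampleUStatistic
  refine Finset.sum_bij (fun (J : Fin k ↪ Fin S.card) _ => S.orderEmbOfFin rfl ∘ J) ?_ ?_ ?_ ?_
  · intro J _
    exact mem_injTuples.2 ⟨(S.orderEmbOfFin rfl).injective.comp J.injective,
      fun a => S.orderEmbOfFin_mem rfl _⟩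
  · intro J _ J' _ h
    ext a : 1
    exact (S.orderEmbOfFin rfl).injective (congrFun h a)
  · intro I hI
    obtain ⟨hinj, hmem⟩ := mem_injTuples.1 hI
    have : ∀ a, ∃ b, S.orderEmbOfFin rfl b = I a := fun a => by
      have h : I a ∈ Set.range (S.orderEmbOfFin rfl) := by
        rw [Finset.range_orderEmbOfFin]; exact hmem a
      exact h
    choose J hJ using this
    refine ⟨⟨J, fun a b h => hinj ?_⟩, Finset.mem_univ _, funext hJ⟩
    rw [← hJ a, ← hJ b, h]
  · intro J _
    rfl

lemma uStatistic_range (f : (Fin k → X) → ℝ) {n : ℕ} {x : Fin n → X}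
    (hx : Function.Injective x) :
    uStatistic f (Set.range x) = sampleUStatistic f ⟨n, x⟩ := by
  unfold uStatistic sampleUStatistic
  let F : (Fin k ↪ Fin n) → {y : Fin k → X // Function.Injective y ∧ ∀ i, y i ∈ Set.range x} :=
    fun I => ⟨x ∘ I, hx.comp I.injective, fun i => ⟨I i, rfl⟩⟩
  have hF : Function.Bijective F := by
    constructor
    · intro I J h
      ext a : 1
      exact hx (congrFun (congrArg Subtype.val h) a)
    · rintro ⟨y, hy, hmem⟩
      choose J hJ using id hmem
      refine ⟨⟨J, fun a b h => hy ?_⟩, Subtype.ext (funext hJ)⟩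
      rw [← hJ a, ← hJ b, h]
  rw [← (Equiv.ofBijective F hF).tsum_eq, tsum_fintype]
  rfl

lemma sampleUStatistic_nonneg {f : (Fin k → X) → ℝ} (hf : ∀ x, 0 ≤ f x) (z : FiniteSample X) :
    0 ≤ sampleUStatistic f z :=
  Finset.sum_nonneg fun _ _ => hf _

lemma measurable_sampleUStatistic [MeasurableSpace X] {f : (Fin k → X) → ℝ} (hf : Measurable f) :
    Measurable (sampleUStatistic f : FiniteSample X → ℝ) := by
  intro D hD
  refine measurableSet_finiteSample_iff.2 fun n => ?_
  have : Measurable fun x : Fin n → X => ∑ I : Fin k ↪ Fin n, f (x ∘ I) :=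
    Finset.measurable_fun_sum _ fun I _ => hf.comp
      (measurable_pi_lambda _ fun _ => measurable_pi_apply _)
  exact this hD

end SampleUStatistic

/-! ### The law of a finite Poisson process and measurability of the U-statistic. -/

section Configuration
open scoped NNReal Nat
variable {X : Type*} {τ : X → ℝ}

/-- Expresses counts through void events: `τ` orders the points, and a rational `q` can be placed
between the last of `i + 1` points and the others. By induction, counting events lie in the
`σ`-algebra generated by void events. -/
lemma succ_le_encard_iff (τ : X → ℝ) (hτ : Function.Injective τ) (s : Set X) (i : ℕ) (t : ℝ) :
    ((i + 1 : ℕ) : ℕ∞) ≤ (s ∩ τ ⁻¹' Set.Iic t).encard ↔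
      ∃ q : ℚ, (i : ℕ∞) ≤ (s ∩ τ ⁻¹' Set.Iic (q : ℝ)).encard ∧
        s ∩ τ ⁻¹' Set.Ioc (q : ℝ) t ≠ ∅ := by
  constructor
  · intro h
    obtain ⟨F, hF, hFc⟩ := Set.exists_subset_encard_eq h
    have hFfin : F.Finite := Set.finite_of_encard_eq_coe hFc
    have hFne : F.Nonempty := by
      rw [← Set.encard_ne_zero, hFc]; simp
    obtain ⟨x, hx, hmax⟩ := Set.exists_max_image F τ hFfin hFne
    obtain ⟨y, hyx, hy⟩ : ∃ y < τ x, ∀ z ∈ F \ {x}, τ z ≤ y := by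
      rcases (F \ {x}).eq_empty_or_nonempty with he | hne
      · exact ⟨τ x - 1, by linarith, by simp [he]⟩
      · obtain ⟨z, hz, hzmax⟩ := Set.exists_max_image (F \ {x}) τ hFfin.sdiff hne
        exact ⟨τ z, lt_of_le_of_ne (hmax z hz.1) fun h => hz.2 (hτ h), hzmax⟩
    obtain ⟨q, hyq, hqx⟩ := exists_rat_btwn hyx
    refine ⟨q, ?_, ?_⟩
    · have h1 : (F \ {x}).encard + 1 = (i : ℕ∞) + 1 := by
        rw [Set.encard_sdiff_singleton_add_one hx, hFc]; simp
      have h2 : (F \ {x}).encard = i := by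
        simpa using h1
      rw [← h2]
      exact Set.encard_le_encard fun z hz => ⟨(hF hz.1).1, (hy z hz).trans hyq.le⟩
    · exact Set.Nonempty.ne_empty ⟨x, (hF hx).1, hqx, (hF hx).2⟩
  · rintro ⟨q, hq, hne⟩
    obtain ⟨x, hxs, hqx, hxt⟩ := Set.nonempty_iff_ne_empty.2 hne
    have hx : x ∉ s ∩ τ ⁻¹' Set.Iic (q : ℝ) := fun h => absurd h.2 (not_le.2 hqx)
    have h1 := Set.encard_insert_of_notMem hx
    calc ((i + 1 : ℕ) : ℕ∞) = i + 1 := by simp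
      _ ≤ (insert x (s ∩ τ ⁻¹' Set.Iic (q : ℝ))).encard := by rw [h1]; gcongr
      _ ≤ (s ∩ τ ⁻¹' Set.Iic t).encard := by
        refine Set.encard_le_encard (Set.insert_subset ⟨hxs, hxt⟩ fun z hz => ⟨hz.1, ?_⟩)
        have h2 : τ z ≤ q := hz.2
        exact h2.trans (le_of_lt (lt_of_lt_of_le hqx hxt))

lemma exists_strictMono_enumeration (hτ : Function.Injective τ) {s : Set X} {n : ℕ}
    (hs : s.encard = n) : ∃ x : Fin n → X, StrictMono (τ ∘ x) ∧ Set.range x = s := by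
  classical
  have hfin : (τ '' s).Finite := (Set.finite_of_encard_eq_coe hs).image τ
  have hcard : hfin.toFinset.card = n := by
    have h1 := hfin.encard_eq_coe_toFinset_card
    rw [hτ.encard_image, hs] at h1
    exact_mod_cast h1.symm
  have hmem : ∀ i, ∃ y ∈ s, τ y = hfin.toFinset.orderEmbOfFin hcard i := fun i => by
    have := hfin.toFinset.orderEmbOfFin_mem hcard i
    rwa [hfin.mem_toFinset] at this
  choose x hxs hx using hmem
  refine ⟨x, ?_, ?_⟩
  · rw [show τ ∘ x = hfin.toFinset.orderEmbOfFin hcard from funext hx]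
    exact (hfin.toFinset.orderEmbOfFin hcard).strictMono
  · ext y
    constructor
    · rintro ⟨i, rfl⟩; exact hxs i
    · intro hy
      have : τ y ∈ Set.range (hfin.toFinset.orderEmbOfFin hcard) := by
        rw [Finset.range_orderEmbOfFin]; simpa using ⟨y, hy, rfl⟩
      obtain ⟨i, hi⟩ := this
      exact ⟨i, hτ ((hx i).trans hi)⟩

/-- The point with index `i` in increasing order is the `(i + 1)`-st, so bounding its `τ`-value is a
counting event. This makes the ordered enumeration measurable. -/
lemma le_iff_succ_le_encard {n : ℕ} {x : Fin n → X} (hx : StrictMono (τ ∘ x)) (i : Fin n)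
    (t : ℝ) : τ (x i) ≤ t ↔
      ((i + 1 : ℕ) : ℕ∞) ≤ (Set.range x ∩ τ ⁻¹' Set.Iic t).encard := by
  have hinj : Function.Injective x := hx.injective.of_comp
  have h1 : Set.range x ∩ τ ⁻¹' Set.Iic t = x '' {j | τ (x j) ≤ t} := by
    ext y
    constructor
    · rintro ⟨⟨j, rfl⟩, hj⟩; exact ⟨j, hj, rfl⟩
    · rintro ⟨j, hj, rfl⟩; exact ⟨⟨j, rfl⟩, hj⟩
  rw [h1, hinj.encard_image]
  constructor
  · intro h
    calc ((i + 1 : ℕ) : ℕ∞) = (Set.Iic i).encard := by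
          rw [← Finset.coe_Iic, Set.encard_coe_eq_coe_finsetCard, Fin.card_Iic]
      _ ≤ _ := Set.encard_le_encard fun j hj => (hx.monotone hj).trans h
  · intro h
    by_contra hc
    push Not at hc
    have : (Set.encard {j | τ (x j) ≤ t}) ≤ (i : ℕ) := by
      calc _ ≤ (Set.Iio i).encard := Set.encard_le_encard fun j hj =>
            hx.lt_iff_lt.1 (lt_of_le_of_lt hj hc)
        _ = (i : ℕ) := by
          rw [← Finset.coe_Iio, Set.encard_coe_eq_coe_finsetCard, Fin.card_Iio]
    have h2 := h.trans this
    have : (i : ℕ) + 1 ≤ i := by exact_mod_cast h2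
    omega

/-- Subsets of `X`, with the `σ`-algebra generated by the events that a measurable set contains
no point. -/
structure Configuration (X : Type*) where
  /-- The points of the configuration. -/
  carrier : Set X

/-- The event that `A` contains no point of the configuration. -/
def voidEvent (A : Set X) : Set (Configuration X) := {s | s.carrier ∩ A = ∅}

/-- The configuration of the points of a sample. -/
def FiniteSample.points (z : FiniteSample X) : Configuration X := ⟨Set.range z.2⟩

lemma preimage_points_voidEvent (A : Set X) (n : ℕ) :
    FiniteSample.mk n ⁻¹' (FiniteSample.points ⁻¹' voidEvent A)
      = Set.univ.pi fun _ : Fin n => Aᶜ := by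
  ext x
  simp only [voidEvent, FiniteSample.points, FiniteSample.mk, Set.mem_preimage,
    Set.mem_ofPred_eq, Set.mem_pi, Set.mem_univ, true_imp_iff, Set.mem_compl_iff]
  rw [Set.eq_empty_iff_forall_notMem]
  constructor
  · exact fun h i hi => h (x i) ⟨⟨i, rfl⟩, hi⟩
  · rintro h _ ⟨⟨i, rfl⟩, hi⟩
    exact h i hi

variable [MeasurableSpace X]

instance : MeasurableSpace (Configuration X) :=
  MeasurableSpace.generateFrom {V | ∃ A : Set X, MeasurableSet A ∧ voidEvent A = V}

lemma measurableSet_voidEvent {A : Set X} (hA : MeasurableSet A) :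
    MeasurableSet (voidEvent A) :=
  MeasurableSpace.measurableSet_generateFrom ⟨A, hA, rfl⟩

lemma isPiSystem_voidEvent :
    IsPiSystem {V : Set (Configuration X) | ∃ A : Set X, MeasurableSet A ∧ voidEvent A = V} := by
  rintro _ ⟨A, hA, rfl⟩ _ ⟨B, hB, rfl⟩ _
  refine ⟨A ∪ B, hA.union hB, ?_⟩
  ext s
  simp [voidEvent, Set.inter_union_distrib_left]

lemma IsPoissonProcess.measurable [TopologicalSpace X] {Ω : Type*} [MeasurableSpace Ω]
    {μ : Measure X} {P : Measure Ω} {η : Ω → Set X} (hη : IsPoissonProcess μ P η) :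
    Measurable (fun ω => (Configuration.mk (η ω))) := by
  refine measurable_generateFrom ?_
  rintro _ ⟨A, hA, rfl⟩
  have := hη.measurable_count A hA (measurableSet_singleton (0 : ℕ∞))
  convert this using 1
  ext ω
  simp [voidEvent]

lemma measurable_points : Measurable (FiniteSample.points : FiniteSample X → Configuration X) := by
  refine measurable_generateFrom ?_
  rintro _ ⟨A, hA, rfl⟩
  refine measurableSet_finiteSample_iff.2 fun n => ?_
  rw [preimage_points_voidEvent]
  exact MeasurableSet.univ_pi fun _ => hA.compl

lemma poissonSampleLaw_voidEvent (r : ℝ≥0) (ρ : Measure X) [IsProbabilityMeasure ρ]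
    {A : Set X} (hA : MeasurableSet A) :
    (poissonSampleLaw r ρ).real (FiniteSample.points ⁻¹' voidEvent A)
      = Real.exp (-(r * ρ.real A)) := by
  have h1 := hasSum_poissonSampleLaw r ρ (measurable_points (measurableSet_voidEvent hA))
  have h2 : ∀ n : ℕ, (Measure.pi fun _ : Fin n => ρ).real
      (FiniteSample.mk n ⁻¹' (FiniteSample.points ⁻¹' voidEvent A)) = (1 - ρ.real A) ^ n := by
    intro n
    rw [preimage_points_voidEvent, measureReal_def, Measure.pi_pi, Finset.prod_const, Finset.card_fin,
      ENNReal.toReal_pow, ← measureReal_def, probReal_compl_eq_one_sub hA]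
  simp only [h2] at h1
  refine h1.unique ?_
  have h3 := (NormedSpace.expSeries_div_hasSum_exp (r * (1 - ρ.real A) : ℝ)).mul_left
    (Real.exp (-r))
  rw [← Real.exp_eq_exp_ℝ, ← Real.exp_add] at h3
  convert! h3 using 1
  · funext n
    rw [mul_pow]; ring
  · congr 1; ring

/-- A Poisson process with finite intensity measure is distributed as the set of points of a
sample of Poisson distributed size. -/
theorem IsPoissonProcess.map_eq [TopologicalSpace X] {Ω : Type*} [MeasurableSpace Ω]
    {μ : Measure X} {P : Measure Ω} [IsProbabilityMeasure P] {η : Ω → Set X}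
    (hη : IsPoissonProcess μ P η) (r : ℝ≥0) (ρ : Measure X) [IsProbabilityMeasure ρ]
    (hμ : μ = r • ρ) :
    P.map (fun ω => (Configuration.mk (η ω)))
      = (poissonSampleLaw r ρ).map FiniteSample.points := by
  have := Measure.isProbabilityMeasure_map (μ := P) hη.measurable.aemeasurable
  have := Measure.isProbabilityMeasure_map (μ := poissonSampleLaw r ρ)
    (measurable_points (X := X)).aemeasurable
  -- Void events form a generating `π`-system, so it suffices to match void probabilities: both
  -- sides give `exp (-μ A)`.
  refine ext_of_generate_finite _ rfl isPiSystem_voidEvent ?_ (by simp)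
  rintro _ ⟨A, hA, rfl⟩
  rw [Measure.map_apply hη.measurable (measurableSet_voidEvent hA),
    Measure.map_apply measurable_points (measurableSet_voidEvent hA),
    ← ENNReal.ofReal_toReal (measure_ne_top (poissonSampleLaw r ρ) _), ← measureReal_def,
    poissonSampleLaw_voidEvent r ρ hA]
  have hμA : μ A = r * ρ A := by rw [hμ]; rfl
  have hfin : μ A ≠ ⊤ := by rw [hμA]; exact ENNReal.mul_ne_top ENNReal.coe_ne_top (measure_ne_top _ _)
  have h1 := congrArg (fun m => m {(0 : ℕ∞)}) (hη.poisson_count A hA hfin)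
  rw [Measure.map_apply (hη.measurable_count A hA) (measurableSet_singleton _),
    Measure.map_apply (measurable_of_countable _) (measurableSet_singleton _)] at h1
  have e1 : (fun n : ℕ => (n : ℕ∞)) ⁻¹' {0} = {0} := by ext n; simp
  have e2 : (fun ω => (η ω ∩ A).encard) ⁻¹' {0}
      = (fun ω => (Configuration.mk (η ω))) ⁻¹' voidEvent A := by
    ext ω; simp [voidEvent]
  rw [e1, e2, poissonMeasure_singleton] at h1
  rw [h1, hμA]
  simp [measureReal_def]
  rfl

lemma measurableSet_le_encard_Iic (hτ : MeasurableEmbedding τ) (i : ℕ) :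
    ∀ t : ℝ, MeasurableSet {s : Configuration X | (i : ℕ∞) ≤ Set.encard (s.carrier ∩ τ ⁻¹' Set.Iic t)} := by
  induction i with
  | zero => intro t; simp
  | succ i ih =>
    intro t
    simp only [succ_le_encard_iff τ hτ.injective]
    rw [Set.ofPred_exists]
    refine MeasurableSet.iUnion fun q => (ih q).inter ?_
    exact (measurableSet_voidEvent (hτ.measurable measurableSet_Ioc)).compl

lemma measurableSet_le_encard (hτ : MeasurableEmbedding τ) (i : ℕ) :
    MeasurableSet {s : Configuration X | (i : ℕ∞) ≤ Set.encard s.carrier} := by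
  have : {s : Configuration X | (i : ℕ∞) ≤ Set.encard s.carrier}
      = ⋃ N : ℕ, {s : Configuration X | (i : ℕ∞) ≤ Set.encard (s.carrier ∩ τ ⁻¹' Set.Iic (N : ℝ))} := by
    ext s
    simp only [Set.mem_ofPred_eq, Set.mem_iUnion]
    constructor
    · intro h
      obtain ⟨F, hF, hFc⟩ := Set.exists_subset_encard_eq h
      obtain ⟨M, hM⟩ := ((Set.finite_of_encard_eq_coe hFc).image τ).bddAbove
      obtain ⟨N, hN⟩ := exists_nat_ge M
      refine ⟨N, hFc ▸ Set.encard_le_encard fun x hx => ⟨hF hx, ?_⟩⟩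
      exact (hM ⟨x, hx, rfl⟩).trans hN
    · rintro ⟨N, hN⟩
      exact hN.trans (Set.encard_le_encard Set.inter_subset_left)
  rw [this]
  exact MeasurableSet.iUnion fun N => measurableSet_le_encard_Iic hτ i N

lemma measurableSet_encard_eq (hτ : MeasurableEmbedding τ) (n : ℕ) :
    MeasurableSet {s : Configuration X | Set.encard s.carrier = n} := by
  have : {s : Configuration X | Set.encard s.carrier = n}
      = {s : Configuration X | (n : ℕ∞) ≤ Set.encard s.carrier} \
        {s : Configuration X | ((n + 1 : ℕ) : ℕ∞) ≤ Set.encard s.carrier} := by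
    ext s
    simp only [Set.mem_ofPred_eq, Set.mem_sdiff, not_le]
    rw [Nat.cast_add, Nat.cast_one, ENat.lt_natCast_add_one_iff]
    exact ⟨fun h => ⟨h.ge, h.le⟩, fun h => le_antisymm h.2 h.1⟩
  rw [this]
  exact (measurableSet_le_encard hτ n).diff (measurableSet_le_encard hτ (n + 1))

/-- There is a measurable enumeration of the configurations with `n` points. -/
lemma exists_measurable_enumeration [Nonempty X] (hτ : MeasurableEmbedding τ) (n : ℕ) :
    ∃ e : Configuration X → Fin n → X, Measurable e ∧ ∀ s : Configuration X,
      Set.encard s.carrier = n → Function.Injective (e s) ∧ Set.range (e s) = s.carrier := by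
  classical
  obtain ⟨x₀⟩ := ‹Nonempty X›
  -- Off the measurable event of having `n` points the enumeration takes a constant default, which
  -- keeps it measurable.
  let e : Configuration X → Fin n → X := fun s =>
    if h : Set.encard s.carrier = n then (exists_strictMono_enumeration hτ.injective h).choose
    else fun _ => x₀
  have he : ∀ s : Configuration X, Set.encard s.carrier = n →
      StrictMono (τ ∘ e s) ∧ Set.range (e s) = s.carrier := by
    intro s h
    simp only [e, dif_pos h]
    exact (exists_strictMono_enumeration hτ.injective h).choose_spec
  refine ⟨e, measurable_pi_lambda _ fun i => ?_, fun s h =>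
    ⟨(he s h).1.injective.of_comp, (he s h).2⟩⟩
  rw [← hτ.measurable_comp_iff]
  refine measurable_of_Iic fun t => ?_
  have : (τ ∘ fun s => e s i) ⁻¹' Set.Iic t
      = ({s : Configuration X | Set.encard s.carrier = n} ∩
          {s : Configuration X | ((i + 1 : ℕ) : ℕ∞) ≤ Set.encard (s.carrier ∩ τ ⁻¹' Set.Iic t)}) ∪
        ({s : Configuration X | Set.encard s.carrier = n}ᶜ ∩ {_s | τ x₀ ≤ t}) := by
    ext s
    by_cases h : Set.encard s.carrier = n
    · have := le_iff_succ_le_encard (he s h).1 i t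
      rw [(he s h).2] at this
      simp only [Set.mem_preimage, Function.comp, Set.mem_Iic, this, Set.mem_union, Set.mem_inter_iff,
        Set.mem_ofPred_eq, h, Set.mem_compl_iff]
      simp
    · simp only [Set.mem_preimage, Function.comp, Set.mem_Iic, Set.mem_union, Set.mem_inter_iff,
        Set.mem_ofPred_eq, h, Set.mem_compl_iff, e]
      simp
  rw [this]
  exact ((measurableSet_encard_eq hτ n).inter (measurableSet_le_encard_Iic hτ _ t)).union
    ((measurableSet_encard_eq hτ n).compl.inter (MeasurableSet.const _))

lemma measurableSet_finite (hτ : MeasurableEmbedding τ) :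
    MeasurableSet {s : Configuration X | Set.Finite s.carrier} := by
  have : {s : Configuration X | Set.Finite s.carrier}
      = ⋃ n : ℕ, {s : Configuration X | Set.encard s.carrier = n} := by
    ext s
    simp only [Set.mem_ofPred_eq, Set.mem_iUnion]
    exact ⟨fun h => ⟨_, h.encard_eq_coe_toFinset_card⟩, fun ⟨n, h⟩ => Set.finite_of_encard_eq_coe h⟩
  rw [this]
  exact MeasurableSet.iUnion fun n => measurableSet_encard_eq hτ n

lemma measurableSet_uStatistic [Nonempty X] (hτ : MeasurableEmbedding τ) {k : ℕ}
    {f : (Fin k → X) → ℝ} (hf : Measurable f) {D : Set ℝ} (hD : MeasurableSet D) :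
    MeasurableSet {s : Configuration X | Set.Finite s.carrier ∧ uStatistic f s.carrier ∈ D} := by
  choose e hem he using exists_measurable_enumeration (τ := τ) hτ
  have : {s : Configuration X | Set.Finite s.carrier ∧ uStatistic f s.carrier ∈ D}
      = ⋃ n : ℕ, {s : Configuration X | Set.encard s.carrier = n} ∩
        {s | sampleUStatistic f (FiniteSample.mk n (e n s)) ∈ D} := by
    ext s
    simp only [Set.mem_ofPred_eq, Set.mem_iUnion, Set.mem_inter_iff]
    have key : ∀ n : ℕ, Set.encard s.carrier = n →
        uStatistic f s.carrier = sampleUStatistic f (FiniteSample.mk n (e n s)) := by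
      intro n h
      have := uStatistic_range f (he n s h).1
      rw [(he n s h).2] at this
      exact this
    constructor
    · rintro ⟨h, hD⟩
      refine ⟨_, h.encard_eq_coe_toFinset_card, ?_⟩
      rwa [← key _ h.encard_eq_coe_toFinset_card]
    · rintro ⟨n, h, hD⟩
      refine ⟨Set.finite_of_encard_eq_coe h, ?_⟩
      rwa [key n h]
  rw [this]
  exact MeasurableSet.iUnion fun n => (measurableSet_encard_eq hτ n).inter
    (((measurable_sampleUStatistic hf).comp ((measurable_finiteSampleMk n).comp (hem n))) hD)

lemma measurableEmbedding_finiteSampleMk (n : ℕ) :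
    MeasurableEmbedding (FiniteSample.mk n : (Fin n → X) → FiniteSample X) where
  injective := fun _ _ h => eq_of_heq (Sigma.mk.inj h).2
  measurable := measurable_finiteSampleMk n
  measurableSet_image' := by
    intro s hs
    refine measurableSet_finiteSample_iff.2 fun m => ?_
    by_cases h : m = n
    · subst h
      rwa [Set.preimage_image_eq _ (show Function.Injective (FiniteSample.mk m) from
        fun _ _ h => eq_of_heq (Sigma.mk.inj h).2)]
    · convert MeasurableSet.empty
      ext x
      simp only [Set.mem_preimage, Set.mem_image, Set.mem_empty_iff_false, iff_false]
      rintro ⟨y, -, hy⟩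
      exact h (congrArg Sigma.fst hy).symm

lemma ae_poissonSampleLaw (r : ℝ≥0) (ρ : Measure X) {p : FiniteSample X → Prop}
    (h : ∀ n, ∀ᵐ x ∂(Measure.pi fun _ : Fin n => ρ), p (FiniteSample.mk n x)) :
    ∀ᵐ z ∂(poissonSampleLaw r ρ), p z := by
  rw [poissonSampleLaw, Measure.ae_sum_iff]
  exact fun n => Measure.ae_smul_measure
    (((measurableEmbedding_finiteSampleMk n).ae_map_iff).2 (h n)) _

/-- Without atoms the diagonal is null by Fubini. Hence almost surely no sample point is repeated,
and the U-statistic of the point set agrees with that of the sample. -/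
lemma ae_injective_pi [MeasurableEq X] (ρ : Measure X) [IsProbabilityMeasure ρ]
    [NullSingletonClass ρ] (n : ℕ) :
    ∀ᵐ x ∂(Measure.pi fun _ : Fin n => ρ), Function.Injective x := by
  have h : ∀ i j : Fin n, i ≠ j → ∀ᵐ x ∂(Measure.pi fun _ : Fin n => ρ), x i ≠ x j := by
    intro i j hij
    have hind : iIndepFun (fun (i : Fin n) (Y : Fin n → X) => Y i)
        (Measure.pi fun _ : Fin n => ρ) :=
      iIndepFun_pi (X := fun _ x => x) fun _ => aemeasurable_id
    have h1 := (indepFun_iff_map_prod_eq_prod_map_map (measurable_pi_apply i).aemeasurable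
      (measurable_pi_apply j).aemeasurable).1 (hind.indepFun hij)
    have hi : ∀ i, (Measure.pi fun _ : Fin n => ρ).map (fun Y => Y i) = ρ := fun i =>
      (measurePreserving_eval (fun _ : Fin n => ρ) i).map_eq
    rw [hi, hi] at h1
    have hm : Measurable fun Y : Fin n → X => (Y i, Y j) :=
      (measurable_pi_apply i).prodMk (measurable_pi_apply j)
    have h2 : (ρ.prod ρ) (Set.diagonal X) = 0 := by
      rw [Measure.prod_apply measurableSet_diagonal]
      have : ∀ x : X, Prod.mk x ⁻¹' Set.diagonal X = {x} := fun x => by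
        ext y; simp [eq_comm]
      simp [this]
    rw [← h1, Measure.map_apply hm measurableSet_diagonal] at h2
    rw [ae_iff]
    refine (congrArg _ ?_).trans h2
    ext x
    simp
  have h' : ∀ᵐ x ∂(Measure.pi fun _ : Fin n => ρ), ∀ i j : Fin n, i ≠ j → x i ≠ x j := by
    rw [ae_all_iff]; intro i
    rw [ae_all_iff]; intro j
    by_cases hij : i = j
    · simp [hij]
    · filter_upwards [h i j hij] with x hx _ using hx
  filter_upwards [h'] with x hx i j hij
  by_contra hc
  exact hx i j hc hij

/-- The distribution of the `U`-statistic of a Poisson process. -/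
theorem IsPoissonProcess.measure_uStatistic [TopologicalSpace X] [MeasurableEq X] [Nonempty X]
    (hτ : MeasurableEmbedding τ) {Ω : Type*} [MeasurableSpace Ω]
    {μ : Measure X} {P : Measure Ω} [IsProbabilityMeasure P] {η : Ω → Set X}
    (hη : IsPoissonProcess μ P η) (r : ℝ≥0) (ρ : Measure X) [IsProbabilityMeasure ρ]
    [NullSingletonClass ρ] (hμ : μ = r • ρ) {k : ℕ} {f : (Fin k → X) → ℝ} (hf : Measurable f)
    {D : Set ℝ} (hD : MeasurableSet D) :
    P {ω | uStatistic f (η ω) ∈ D} = poissonSampleLaw r ρ {z | sampleUStatistic f z ∈ D} := by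
  have hmap := hη.map_eq r ρ hμ
  have key : ∀ S : Set (Configuration X), MeasurableSet S →
      P ((fun ω => (Configuration.mk (η ω))) ⁻¹' S)
        = poissonSampleLaw r ρ (FiniteSample.points ⁻¹' S) := fun S hS => by
    rw [← Measure.map_apply hη.measurable hS, hmap, Measure.map_apply measurable_points hS]
  have hfin : ∀ᵐ ω ∂P, (η ω).Finite := by
    have h1 := key _ (measurableSet_finite (X := X) hτ).compl
    have h2 : FiniteSample.points ⁻¹' {s : Configuration X | Set.Finite s.carrier}ᶜ = ∅ := by
      ext z
      simp only [FiniteSample.points, Set.mem_preimage, Set.mem_compl_iff, Set.mem_ofPred_eq,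
        Set.mem_empty_iff_false, iff_false, not_not]
      exact Set.finite_range z.2
    rw [h2, measure_empty] at h1
    exact h1
  have hinj : ∀ᵐ z ∂(poissonSampleLaw r ρ), Function.Injective z.2 :=
    ae_poissonSampleLaw r ρ fun n => ae_injective_pi ρ n
  have h1 := key _ (measurableSet_uStatistic hτ hf hD)
  have e1 : P {ω | uStatistic f (η ω) ∈ D} = P ((fun ω => (Configuration.mk (η ω))) ⁻¹'
      {s : Configuration X | Set.Finite s.carrier ∧ uStatistic f s.carrier ∈ D}) := by
    refine measure_congr ?_
    filter_upwards [hfin] with ω hω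
    refine propext ⟨fun h => ⟨hω, h⟩, fun h => h.2⟩
  rw [e1, h1]
  refine measure_congr ?_
  filter_upwards [hinj] with z hz
  have := uStatistic_range f hz
  refine propext ⟨fun h => ?_, fun h => ⟨Set.finite_range z.2, ?_⟩⟩
  · have h2 := h.2
    simp only [FiniteSample.points, this] at h2
    exact h2
  · simp only [FiniteSample.points, this]
    exact h

end Configuration

/-! ### Exponential tail bounds. -/

section Tails
open scoped NNReal Nat

lemma hasSum_nat_mul_pow_div_factorial (y : ℝ) :
    HasSum (fun n : ℕ => n * (y ^ n / n !)) (y * Real.exp y) := by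
  rw [← hasSum_nat_add_iff' 1]
  have h := (NormedSpace.expSeries_div_hasSum_exp y).mul_left y
  rw [← Real.exp_eq_exp_ℝ] at h
  convert! h using 1
  · funext n
    rw [Nat.factorial_succ]
    push_cast
    field_simp
    exact pow_succ' y n
  · simp

variable {X : Type*} [MeasurableSpace X]

/-- Since `Q > 0`, the indicator of `Q ≤ N` is at most `N * exp ((N - Q) / 4)`. The factor `N`
produces the factor `r`, which the plain Chernoff bound would miss for small `r`. -/
lemma poissonSampleLaw_size_ge_le {r : ℝ≥0} (hr : (r : ℝ) ≤ 3 / 2) (ρ : Measure X)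
    [IsProbabilityMeasure ρ] {Q : ℝ} (hQ : 0 < Q) :
    (poissonSampleLaw r ρ).real {z | Q ≤ z.1} ≤ 2 * r * Real.exp (-(Q / 4)) := by
  have hm : MeasurableSet {z : FiniteSample X | Q ≤ z.1} :=
    measurableSet_finiteSample_iff.2 fun n => MeasurableSet.const (Q ≤ n)
  set y : ℝ := r * Real.exp (1 / 4) with hy
  have h1 := ((hasSum_nat_mul_pow_div_factorial y).mul_left (Real.exp (-r) * Real.exp (-(Q / 4))))
  refine (hasSum_le (fun n => ?_) (hasSum_poissonSampleLaw r ρ hm) h1).trans ?_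
  · by_cases h : Q ≤ n
    · have hn : (1 : ℝ) ≤ n := by
        rcases Nat.eq_zero_or_pos n with rfl | hn
        · simp at h; linarith
        · exact_mod_cast hn
      have e1 : (1 : ℝ) ≤ n * (Real.exp (1 / 4) ^ n * Real.exp (-(Q / 4))) := by
        rw [← Real.exp_nat_mul, ← Real.exp_add]
        have : (1 : ℝ) ≤ Real.exp (n * (1 / 4) + -(Q / 4)) :=
          Real.one_le_exp (by linarith)
        nlinarith
      calc _ ≤ Real.exp (-r) * r ^ n / n ! * 1 := by
            gcongr
            exact measureReal_le_one
        _ ≤ Real.exp (-r) * r ^ n / n ! * (n * (Real.exp (1 / 4) ^ n * Real.exp (-(Q / 4)))) := by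
            gcongr
        _ = _ := by rw [hy, mul_pow]; ring
    · have : FiniteSample.mk n ⁻¹' {z : FiniteSample X | Q ≤ z.1} = ∅ := by
        ext x; simpa [FiniteSample.mk] using h
      rw [this, measureReal_empty, mul_zero]
      positivity
  -- The threshold `3 / 2` enters here: `1 / 4 + 0.285 * (3 / 2) < log 2`.
  · have e4 : Real.exp (1 / 4) ≤ 1.285 := by
      by_contra hc
      push Not at hc
      have h4 : (1.285 : ℝ) ^ 4 ≤ Real.exp (1 / 4) ^ 4 := by gcongr
      have e1 : Real.exp (1 / 4) ^ 4 = Real.exp 1 := by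
        rw [← Real.exp_nat_mul]; norm_num
      have e3 := Real.exp_one_lt_d9
      norm_num at h4
      linarith
    have key : Real.exp (-r) * Real.exp (1 / 4) * Real.exp y ≤ 2 := by
      rw [← Real.exp_add, ← Real.exp_add, ← Real.exp_log two_pos]
      apply Real.exp_le_exp.2
      have := Real.log_two_gt_d9
      have hr0 : (0 : ℝ) ≤ r := r.2
      nlinarith [mul_le_mul_of_nonneg_left e4 hr0]
    calc _ = (Real.exp (-r) * Real.exp (1 / 4) * Real.exp y) * r * Real.exp (-(Q / 4)) := by
          rw [hy]; ring
      _ ≤ _ := by gcongr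

/-- Chernoff's bound with parameter `2`: the variable `exp (2 * 1_B)` has mean `1 + (e² - 1) * ρ B`,
and independence gives the power. -/
lemma pi_count_ge_le (ρ : Measure X) [IsProbabilityMeasure ρ] {B : Set X} (hB : MeasurableSet B)
    [DecidablePred (· ∈ B)] {b : ℝ} (hb : ρ.real B ≤ b) (Q : ℝ) (m : ℕ) :
    (Measure.pi fun _ : Fin m => ρ).real
        {w | Q ≤ ((Finset.univ.filter fun j => w j ∈ B).card : ℝ)}
      ≤ Real.exp (-(2 * Q)) * (1 + (Real.exp 2 - 1) * b) ^ m := by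
  have he : (1 : ℝ) ≤ Real.exp 2 := Real.one_le_exp (by norm_num)
  set h : X → ℝ := fun x => 1 + B.indicator (fun _ => Real.exp 2 - 1) x with hh
  have hpos : ∀ x, 1 ≤ h x := fun x => by
    have : 0 ≤ B.indicator (fun _ => Real.exp 2 - 1) x :=
      Set.indicator_nonneg (fun _ _ => by linarith) x
    simp only [hh]; linarith
  have hint : Integrable h ρ := (integrable_const 1).add ((integrable_const _).indicator hB)
  have hval : ∫ x, h x ∂ρ ≤ 1 + (Real.exp 2 - 1) * b := by
    rw [hh, integral_add (integrable_const 1) ((integrable_const _).indicator hB),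
      integral_indicator_const _ hB]
    simp only [integral_const, probReal_univ, smul_eq_mul, one_mul]
    nlinarith
  have hprod : ∀ w : Fin m → X, ∏ j, h (w j)
      = Real.exp (2 * ((Finset.univ.filter fun j => w j ∈ B).card : ℝ)) := by
    intro w
    have : ∀ j, h (w j) = if w j ∈ B then Real.exp 2 else 1 := fun j => by
      by_cases hj : w j ∈ B <;> simp [hh, hj]
    simp only [this]
    rw [Finset.prod_ite, Finset.prod_const, Finset.prod_const_one, mul_one, ← Real.exp_nat_mul,
      mul_comm]
  have hsub : {w : Fin m → X | Q ≤ ((Finset.univ.filter fun j => w j ∈ B).card : ℝ)}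
      = {w | Real.exp (2 * Q) ≤ ∏ j, h (w j)} := by
    ext w
    simp only [Set.mem_ofPred_eq, hprod, Real.exp_le_exp]
    constructor <;> intro h <;> linarith
  have hM := mul_meas_ge_le_integral_of_nonneg (μ := Measure.pi fun _ : Fin m => ρ)
    (f := fun w => ∏ j, h (w j))
    (Filter.Eventually.of_forall fun w => Finset.prod_nonneg fun j _ =>
      zero_le_one.trans (hpos (w j))) (Integrable.fintype_prod fun _ => hint) (Real.exp (2 * Q))
  rw [integral_fintype_prod_eq_prod (fun _ : Fin m => h), Finset.prod_const, Finset.card_fin,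
    ← hsub] at hM
  rw [Real.exp_neg, ← div_eq_inv_mul, le_div_iff₀' (Real.exp_pos _)]
  refine hM.trans ?_
  have : 0 ≤ ∫ x, h x ∂ρ := integral_nonneg fun x => zero_le_one.trans (hpos x)
  gcongr

end Tails

/-! ### Samples with a crowded neighbourhood are rare. -/

section Crowded
open scoped NNReal Nat
variable {X : Type*} [MetricSpace X]

/-- The samples with a point that has at least `Q` other points within distance `δ`. -/
def crowded (X : Type*) [MetricSpace X] (δ Q : ℝ) : Set (FiniteSample X) :=
  {z | ∃ i, Q ≤ ((Finset.univ.filter fun j => j ≠ i ∧ dist (z.2 j) (z.2 i) ≤ δ).card : ℝ)}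

lemma preimage_crowded (δ Q : ℝ) (n : ℕ) :
    FiniteSample.mk n ⁻¹' crowded X δ Q = ⋃ i : Fin n, {x : Fin n → X | Q ≤
      ((Finset.univ.filter fun j => j ≠ i ∧ dist (x j) (x i) ≤ δ).card : ℝ)} := by
  ext x
  simp only [Set.mem_iUnion]
  rfl

variable [SecondCountableTopology X] [MeasurableSpace X] [BorelSpace X]

lemma measurableSet_card_filter_ge {ι Y : Type*} [Fintype ι] [MeasurableSpace Y]
    {p : ι → Y → Prop} [∀ i y, Decidable (p i y)] (hp : ∀ i, MeasurableSet {y | p i y}) (Q : ℝ) :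
    MeasurableSet {y | Q ≤ ((Finset.univ.filter fun i => p i y).card : ℝ)} := by
  simp only [Finset.card_filter, Nat.cast_sum, Nat.cast_ite, Nat.cast_one, Nat.cast_zero]
  exact measurableSet_le measurable_const (Finset.measurable_fun_sum _ fun i _ =>
    Measurable.ite (hp i) measurable_const measurable_const)

lemma measurableSet_crowded_index (δ Q : ℝ) {n : ℕ} (i : Fin n) :
    MeasurableSet {x : Fin n → X | Q ≤
      ((Finset.univ.filter fun j => j ≠ i ∧ dist (x j) (x i) ≤ δ).card : ℝ)} :=
  measurableSet_card_filter_ge (p := fun j (x : Fin n → X) => j ≠ i ∧ dist (x j) (x i) ≤ δ)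
    (fun j => (MeasurableSet.const (j ≠ i)).inter (measurableSet_le
      ((measurable_pi_apply j).dist (measurable_pi_apply i)) measurable_const)) Q

lemma measurableSet_crowded (δ Q : ℝ) : MeasurableSet (crowded X δ Q) := by
  refine measurableSet_finiteSample_iff.2 fun n => ?_
  rw [preimage_crowded]
  exact MeasurableSet.iUnion fun i => measurableSet_crowded_index δ Q i

/-- Conditionally on the point with index `i`, the other `m` points are i.i.d. and are counted in a
fixed ball. -/
lemma pi_crowded_index_le (ρ : Measure X) [IsProbabilityMeasure ρ] {δ b : ℝ}
    (hb : ∀ x, ρ.real (Metric.closedBall x δ) ≤ b) (Q : ℝ) (m : ℕ) (i : Fin (m + 1)) :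
    (Measure.pi fun _ : Fin (m + 1) => ρ).real {x | Q ≤
      ((Finset.univ.filter fun j => j ≠ i ∧ dist (x j) (x i) ≤ δ).card : ℝ)}
      ≤ Real.exp (-(2 * Q)) * (1 + (Real.exp 2 - 1) * b) ^ m := by
  have hmp := measurePreserving_piFinSuccAbove (fun _ : Fin (m + 1) => ρ) i
  set E : Set (X × (Fin m → X)) :=
    {p | Q ≤ ((Finset.univ.filter fun j => dist (p.2 j) p.1 ≤ δ).card : ℝ)} with hE
  have hEm : MeasurableSet E := measurableSet_card_filter_ge (fun j => measurableSet_le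
    (((measurable_pi_apply j).comp measurable_snd).dist measurable_fst) measurable_const) Q
  have hpre : {x : Fin (m + 1) → X | Q ≤
      ((Finset.univ.filter fun j => j ≠ i ∧ dist (x j) (x i) ≤ δ).card : ℝ)}
      = MeasurableEquiv.piFinSuccAbove (fun _ => X) i ⁻¹' E := by
    ext x
    simp only [hE, Set.mem_ofPred_eq, Set.mem_preimage]
    have : (Finset.univ.filter fun j => j ≠ i ∧ dist (x j) (x i) ≤ δ)
        = (Finset.univ.filter fun j : Fin m => dist (x (i.succAbove j)) (x i) ≤ δ).map
          i.succAboveEmb := by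
      ext j
      simp only [Finset.mem_filter, Finset.mem_univ, true_and, Finset.mem_map]
      constructor
      · rintro ⟨hj, hd⟩
        obtain ⟨l, rfl⟩ := Fin.exists_succAbove_eq hj
        exact ⟨l, hd, rfl⟩
      · rintro ⟨l, hd, rfl⟩
        exact ⟨Fin.succAbove_ne i l, hd⟩
    rw [this, Finset.card_map]
    rfl
  have hbound : ∀ y : X, (Measure.pi fun _ : Fin m => ρ) (Prod.mk y ⁻¹' E)
      ≤ ENNReal.ofReal (Real.exp (-(2 * Q)) * (1 + (Real.exp 2 - 1) * b) ^ m) := by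
    intro y
    rw [← ENNReal.ofReal_toReal (measure_ne_top (Measure.pi fun _ : Fin m => ρ) _)]
    classical
    refine ENNReal.ofReal_le_ofReal ((le_of_eq ?_).trans
      (pi_count_ge_le ρ Metric.isClosed_closedBall.measurableSet (hb y) Q m))
    rw [measureReal_def]
    congr 2
  have hb0 : 0 ≤ b := measureReal_nonneg.trans (hb (nonempty_of_isProbabilityMeasure ρ).some)
  have he : (1 : ℝ) ≤ Real.exp 2 := Real.one_le_exp (by norm_num)
  have hnn : 0 ≤ Real.exp (-(2 * Q)) * (1 + (Real.exp 2 - 1) * b) ^ m := by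
    have := sub_nonneg.2 he
    positivity
  refine ENNReal.toReal_le_of_le_ofReal hnn ?_
  rw [hpre, hmp.measure_preimage hEm.nullMeasurableSet, Measure.prod_apply hEm]
  refine (lintegral_mono hbound).trans ?_
  simp

/-- A union bound over the points gives a factor `n`, which averages to the prefactor `r`. Each
point then contributes a Chernoff factor with exponent `-2 * Q + (e² - 1) * r * b`. -/
lemma poissonSampleLaw_crowded_le {r : ℝ≥0} (hr : r ≠ 0) (ρ : Measure X) [IsProbabilityMeasure ρ] {δ Q : ℝ}
    (hQ : ∀ x, r * ρ.real (Metric.closedBall x δ) * Real.exp 2 ≤ Q) :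
    (poissonSampleLaw r ρ).real (crowded X δ Q) ≤ r * Real.exp (-Q) := by
  have hr0 : (0 : ℝ) < r := by exact_mod_cast pos_iff_ne_zero.2 hr
  have he : (1 : ℝ) ≤ Real.exp 2 := Real.one_le_exp (by norm_num)
  -- The largest ball mass allowed by the assumption; then `r * b * e² = Q`, and the exponent is `-Q
  -- - r * b ≤ -Q`.
  set b : ℝ := Q / (r * Real.exp 2) with hb
  have hbb : ∀ x, ρ.real (Metric.closedBall x δ) ≤ b := fun x => by
    rw [hb, le_div_iff₀ (by positivity)]
    linarith [hQ x]
  have hb0 : 0 ≤ b := measureReal_nonneg.trans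
    (hbb (nonempty_of_isProbabilityMeasure ρ).some)
  have he' := sub_nonneg.2 he
  set q : ℝ := 1 + (Real.exp 2 - 1) * b with hq
  have hq0 : 0 < q := by positivity
  have h1 := (hasSum_nat_mul_pow_div_factorial (r * q)).mul_left
    (Real.exp (-r) * Real.exp (-(2 * Q)) / q)
  refine (hasSum_le (fun n => ?_)
    (hasSum_poissonSampleLaw r ρ (measurableSet_crowded (X := X) δ Q)) h1).trans ?_
  · rcases n with _ | m
    · have : FiniteSample.mk 0 ⁻¹' crowded X δ Q = ∅ := by
        ext x; simp [crowded, FiniteSample.mk]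
      rw [this]; simp
    · have h2 : (Measure.pi fun _ : Fin (m + 1) => ρ).real (FiniteSample.mk (m + 1) ⁻¹' crowded X δ Q)
          ≤ (m + 1 : ℕ) * (Real.exp (-(2 * Q)) * q ^ m) := by
        rw [preimage_crowded]
        refine (measureReal_iUnion_fintype_le _).trans ?_
        refine (Finset.sum_le_sum fun i _ => pi_crowded_index_le ρ hbb Q m i).trans (le_of_eq ?_)
        simp [hq]
      calc _ ≤ Real.exp (-r) * r ^ (m + 1) / (m + 1)! *
            ((m + 1 : ℕ) * (Real.exp (-(2 * Q)) * q ^ m)) := by gcongr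
        _ = _ := by rw [mul_pow, pow_succ q]; field_simp
  · have key : Real.exp (-r) * Real.exp (-(2 * Q)) * Real.exp (r * q) ≤ Real.exp (-Q) := by
      rw [← Real.exp_add, ← Real.exp_add]
      apply Real.exp_le_exp.2
      have e1 : (r : ℝ) * b * Real.exp 2 = Q := by rw [hb]; field_simp
      have : (r : ℝ) * q = r + Q - r * b := by rw [hq, ← e1]; ring
      have : 0 ≤ (r : ℝ) * b := by positivity
      linarith
    calc _ = r * (Real.exp (-r) * Real.exp (-(2 * Q)) * Real.exp (r * q)) := by field_simp
      _ ≤ _ := by gcongr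

end Crowded

/-! ### Concentration around the median. -/

section Concentration
open scoped NNReal Nat
variable {X : Type*} {k : ℕ} {f : (Fin k → X) → ℝ} {c Q δ : ℝ}

lemma card_filter_lt_of_subsample_notMem_crowded [MetricSpace X] {L : ℕ} {Y : Fin L → X} {S : Finset (Fin L)}
    (h : subsample Y S ∉ crowded X δ Q) {i : Fin L} (hi : i ∈ S) :
    (((S.erase i).filter fun j => dist (Y j) (Y i) ≤ δ).card : ℝ) < Q := by
  obtain ⟨a, rfl⟩ : ∃ a, S.orderEmbOfFin rfl a = i := by
    have : i ∈ Set.range (S.orderEmbOfFin rfl) := by rw [Finset.range_orderEmbOfFin]; exact hi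
    exact this
  have hlt : ((Finset.univ.filter fun j => j ≠ a ∧
      dist (Y (S.orderEmbOfFin rfl j)) (Y (S.orderEmbOfFin rfl a)) ≤ δ).card : ℝ) < Q := by
    by_contra hc
    exact h ⟨a, not_lt.1 hc⟩
  convert hlt using 2
  rw [← Finset.card_map (S.orderEmbOfFin rfl).toEmbedding]
  congr 1
  ext j
  simp only [Finset.mem_filter, Finset.mem_erase, Finset.mem_map, Finset.mem_univ, true_and]
  constructor
  · rintro ⟨⟨hja, hjS⟩, hd⟩
    have : j ∈ Set.range (S.orderEmbOfFin rfl) := by rw [Finset.range_orderEmbOfFin]; exact hjS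
    obtain ⟨b, rfl⟩ := this
    exact ⟨b, ⟨fun h => hja (by rw [h]), hd⟩, rfl⟩
  · rintro ⟨b, ⟨hb, hd⟩, rfl⟩
    exact ⟨⟨fun h => hb ((S.orderEmbOfFin rfl).injective h), S.orderEmbOfFin_mem rfl b⟩, hd⟩

variable [MeasurableSpace X]

/-- The essential bound transfers because an injective choice of coordinates of an i.i.d. sample is
again i.i.d.; tuples with repeated indices may sit on a null set, where nothing is known. -/
lemma ae_kernel_comp_le {ρ : Measure X} [IsProbabilityMeasure ρ]
    (hfc : ∀ᵐ x ∂(Measure.pi fun _ : Fin k => ρ), f x ≤ c) (L : ℕ) :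
    ∀ᵐ Y ∂(Measure.pi fun _ : Fin L => ρ), ∀ I : Fin k → Fin L, Function.Injective I →
      f (Y ∘ I) ≤ c := by
  rw [ae_all_iff]
  intro I
  by_cases hI : Function.Injective I
  · rw [← map_comp_pi_of_injective ρ hI] at hfc
    have hm : Measurable fun Y : Fin L → X => Y ∘ I :=
      measurable_pi_lambda _ fun _ => measurable_pi_apply _
    filter_upwards [ae_of_ae_map hm.aemeasurable hfc] with Y hY _ using hY
  · exact Filter.Eventually.of_forall fun Y h => absurd h hI

lemma ae_sampleUStatistic_le (r : ℝ≥0) {ρ : Measure X} [IsProbabilityMeasure ρ] (hc : 0 ≤ c)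
    (hfc : ∀ᵐ x ∂(Measure.pi fun _ : Fin k => ρ), f x ≤ c) :
    ∀ᵐ z ∂(poissonSampleLaw r ρ), sampleUStatistic f z ≤ c * (z.1 : ℝ) ^ k := by
  refine ae_poissonSampleLaw r ρ fun n => ?_
  filter_upwards [ae_kernel_comp_le hfc n] with x hx
  calc sampleUStatistic f (FiniteSample.mk n x) ≤ ∑ _I : Fin k ↪ Fin n, c :=
        Finset.sum_le_sum fun I _ => hx I I.injective
    _ = c * Fintype.card (Fin k ↪ Fin n) := by
        rw [Finset.sum_const, nsmul_eq_mul, mul_comm, Finset.card_univ]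
    _ ≤ c * (n : ℝ) ^ k := by
        gcongr
        rw [Fintype.card_embedding_eq, Fintype.card_fin, Fintype.card_fin]
        exact_mod_cast Nat.descFactorial_le_pow n k

variable [MetricSpace X] [SecondCountableTopology X] [BorelSpace X]

/-- Concentration for the `U`-statistic of a local kernel away from the crowded samples. -/
theorem poissonSampleLaw_uStatistic_mul_le (r : ℝ≥0) (ρ : Measure X) [IsProbabilityMeasure ρ]
    (hk : 1 ≤ k) (hf : Measurable f) (hf0 : ∀ x, 0 ≤ f x) (hc : 0 < c)
    (hfc : ∀ᵐ x ∂(Measure.pi fun _ : Fin k => ρ), f x ≤ c) (hloc : IsLocalKernel f δ)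
    (hQ : 0 < Q) {a b : ℝ}
    (hab : ∀ U, b ≤ U → 0 < U ∧ a ≤ U ∧ c * Q ^ k * U ≤ (U - a) ^ 2) :
    (poissonSampleLaw r ρ).real {z | sampleUStatistic f z ≤ a} *
      (poissonSampleLaw r ρ).real ({z | b ≤ sampleUStatistic f z} \ crowded X δ Q)
      ≤ Real.exp (-(Q / (4 * (k : ℝ) ^ 2))) := by
  have hU := measurable_sampleUStatistic hf
  have hd : (√Q / k) ^ 2 / 4 = Q / (4 * (k : ℝ) ^ 2) := by
    rw [div_pow, Real.sq_sqrt hQ.le, div_div, mul_comm]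
  rw [← hd]
  refine poissonSampleLaw_mul_le r ρ (measurableSet_le hU measurable_const)
    ((measurableSet_le measurable_const hU).diff (measurableSet_crowded δ Q))
    (by positivity) fun L => ?_
  filter_upwards [ae_kernel_comp_le hfc L] with Y hY S hS
  have hUS := sampleUStatistic_subsample f Y S
  obtain ⟨h1, h2, h3⟩ := hab _ hS.1
  rw [hUS] at h1 h2 h3
  obtain ⟨α, hα0, hα1, hα⟩ := exists_weights_of_localSum (g := fun I => f (Y ∘ I)) hk hc hQ
    (fun I => hf0 _) hY (fun i j => dist (Y j) (Y i) ≤ δ)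
    (fun I hI a b => hloc _ hI a b) S
    (fun i hi => (card_filter_lt_of_subsample_notMem_crowded hS.2 hi).le) h1 h2 h3
  refine ⟨α, hα0, hα1, fun T hT => hα T ?_⟩
  rwa [← sampleUStatistic_subsample]

/-- The prefactor `r` forces two regimes: convex distance produces an absolute constant in front,
which `4 * r` dominates only for `r > 3 / 2`, while for small `r` the chance of having `Q` points is
itself of order `r`. -/
theorem poissonSampleLaw_abs_sub_median_ge_le {r : ℝ≥0} (hr : r ≠ 0) (ρ : Measure X)
    [IsProbabilityMeasure ρ] (hk : 1 ≤ k) (hf : Measurable f) (hf0 : ∀ x, 0 ≤ f x) (hc : 0 < c)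
    (hfc : ∀ᵐ x ∂(Measure.pi fun _ : Fin k => ρ), f x ≤ c) (hloc : IsLocalKernel f δ)
    (hQ : 0 < Q) (hball : ∀ x, r * ρ.real (Metric.closedBall x δ) * Real.exp 2 ≤ Q)
    {m u : ℝ} (hm0 : 0 ≤ m)
    (hm1 : 1 / 2 ≤ (poissonSampleLaw r ρ).real {z | sampleUStatistic f z ≤ m})
    (hm2 : 1 / 2 ≤ (poissonSampleLaw r ρ).real {z | m ≤ sampleUStatistic f z})
    (hu : 0 < u) (hQu : c * Q ^ k = u ^ 2 / (u + m)) :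
    (poissonSampleLaw r ρ).real {z | u ≤ |sampleUStatistic f z - m|}
      ≤ 4 * r * Real.exp (-(Q / (4 * (k : ℝ) ^ 2))) := by
  set π := (poissonSampleLaw r ρ).real with hπ
  set a := Real.exp (-(Q / (4 * (k : ℝ) ^ 2))) with ha
  have hk1 : (1 : ℝ) ≤ k := by exact_mod_cast hk
  have hum : 0 < u + m := by linarith
  have hr0 : (0 : ℝ) < r := by exact_mod_cast pos_iff_ne_zero.2 hr
  have ha0 : 0 < a := Real.exp_pos _
  have hk2 : (1 : ℝ) ≤ (k : ℝ) ^ 2 := one_le_pow₀ hk1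
  have hexp4 : Real.exp (-(Q / 4)) ≤ a := by
    apply Real.exp_le_exp.2
    rw [neg_le_neg_iff]
    apply div_le_div_of_nonneg_left hQ.le <;> linarith
  have hUnn : ∀ z, 0 ≤ sampleUStatistic f z := sampleUStatistic_nonneg hf0
  have hsize : ∀ᵐ z ∂(poissonSampleLaw r ρ), u ^ 2 / (u + m) ≤ sampleUStatistic f z →
      Q ≤ z.1 := by
    filter_upwards [ae_sampleUStatistic_le r hc.le hfc] with z hz h
    rw [← hQu] at h
    have h1 : Q ^ k ≤ (z.1 : ℝ) ^ k := le_of_mul_le_mul_left (h.trans hz) hc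
    exact le_of_pow_le_pow_left₀ (by omega) (Nat.cast_nonneg _) h1
  have hmono : ∀ {s t : Set (FiniteSample X)}, (∀ᵐ z ∂(poissonSampleLaw r ρ), z ∈ s → z ∈ t) →
      π s ≤ π t := fun h => ENNReal.toReal_mono (measure_ne_top _ _) (measure_mono_ae h)
  rcases le_or_gt (r : ℝ) (3 / 2) with hr32 | hr32
  · have htail := poissonSampleLaw_size_ge_le hr32 ρ hQ
    have htail' : π {z | Q ≤ z.1} ≤ 2 * r * a := htail.trans (by gcongr)
    -- If `u ≤ m`, then `U ≥ m` already forces `N ≥ Q`, so `1 / 2 ≤ 2 * r * a` and the claim is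
    -- trivial. If `u > m`, only the upper deviation is possible, as `U ≥ 0`.
    rcases le_or_gt u m with hle | hlt
    · have h1 : π {z | m ≤ sampleUStatistic f z} ≤ π {z | Q ≤ z.1} := by
        refine hmono ?_
        filter_upwards [hsize] with z hz h
        refine hz (le_trans ?_ h)
        rw [div_le_iff₀ hum]
        nlinarith
      have : π {z | u ≤ |sampleUStatistic f z - m|} ≤ 1 := measureReal_le_one
      linarith
    · have h1 : π {z | u ≤ |sampleUStatistic f z - m|} ≤ π {z | Q ≤ z.1} := by
        refine hmono ?_
        filter_upwards [hsize] with z hz h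
        refine hz ?_
        have hz0 := hUnn z
        have h2 : m + u ≤ sampleUStatistic f z := by
          rcases le_abs.1 (show u ≤ |sampleUStatistic f z - m| from h) with h | h <;> linarith
        refine le_trans ?_ h2
        rw [div_le_iff₀ hum]
        nlinarith
      have : 0 ≤ r * a := by positivity
      linarith
  · rcases le_or_gt 1 (4 * r * a) with h1 | h1
    · exact measureReal_le_one.trans h1
    have ha4 : Real.exp (-Q) ≤ a ^ 4 := by
      rw [ha, ← Real.exp_nat_mul]
      apply Real.exp_le_exp.2
      have : Q / (4 * (k : ℝ) ^ 2) ≤ Q / 4 := by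
        apply div_le_div_of_nonneg_left hQ.le <;> linarith
      push_cast
      linarith
    have hp : π (crowded X δ Q) ≤ r * a ^ 4 :=
      (poissonSampleLaw_crowded_le hr ρ hball).trans (by gcongr)
    -- From `4 * r * a < 1` and `r > 3 / 2`; this makes the crowded samples negligible compared with
    -- `a`.
    have ha6 : a ≤ 1 / 6 := by nlinarith
    have hp2 : π (crowded X δ Q) ≤ a / 144 := by
      refine hp.trans ?_
      have e1 : r * a ^ 4 = (4 * r * a) * a ^ 3 / 4 := by ring
      have e2 : a ^ 3 ≤ a / 36 := by nlinarith [mul_nonneg ha0.le ha0.le]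
      rw [e1]
      nlinarith [pow_pos ha0 3]
    have hsplit : ∀ b, π {z | b ≤ sampleUStatistic f z}
        ≤ π ({z | b ≤ sampleUStatistic f z} \ crowded X δ Q) + π (crowded X δ Q) := fun b =>
      (measureReal_mono (fun z hz => by
        by_cases h : z ∈ crowded X δ Q
        · exact Or.inr h
        · exact Or.inl ⟨hz, h⟩)).trans (measureReal_union_le _ _)
    -- The median gives `{U ≤ m}` probability at least `1 / 2`, hence the factor `2`. The quadratic
    -- condition is an equality at `U = m + u`.
    have hupper : π {z | m + u ≤ sampleUStatistic f z} ≤ 2 * a + a / 144 := by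
      have h2 := poissonSampleLaw_uStatistic_mul_le r ρ hk hf hf0 hc hfc hloc hQ (a := m)
        (b := m + u) fun U hU => ⟨by linarith, by linarith, by
          rw [hQu, div_mul_eq_mul_div, div_le_iff₀ hum]
          obtain ⟨v, hv, rfl⟩ : ∃ v, 0 ≤ v ∧ U = m + u + v := ⟨U - (m + u), by linarith, by ring⟩
          have : 0 ≤ u * v * m := by positivity
          have : 0 ≤ u ^ 2 * v := by positivity
          have : 0 ≤ v ^ 2 * (u + m) := by positivity
          nlinarith⟩
      have h3 := hsplit (m + u)
      have h4 : 0 ≤ π ({z | m + u ≤ sampleUStatistic f z} \ crowded X δ Q) := measureReal_nonneg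
      change π _ * π _ ≤ a at h2
      nlinarith
    -- The likely set is now `{U ≥ m}` without the crowded samples, of probability at least `1 / 2 -
    -- a / 144`, hence `3` instead of `2`.
    have hlower : π {z | sampleUStatistic f z ≤ m - u} ≤ 3 * a := by
      rcases le_or_gt u m with hle | hlt
      · have h2 := poissonSampleLaw_uStatistic_mul_le r ρ hk hf hf0 hc hfc hloc hQ (a := m - u)
          (b := m) fun U hU => ⟨by linarith, by linarith, by
            rw [hQu, div_mul_eq_mul_div, div_le_iff₀ hum]
            obtain ⟨v, hv, rfl⟩ : ∃ v, 0 ≤ v ∧ U = m + v := ⟨U - m, by linarith, by ring⟩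
            have : 0 ≤ u * v * m := by positivity
            have : 0 ≤ u ^ 2 * v := by positivity
            have : 0 ≤ v ^ 2 * (u + m) := by positivity
            have : 0 ≤ u ^ 3 := by positivity
            nlinarith⟩
        have h3 := hsplit m
        have h4 : 0 ≤ π {z | sampleUStatistic f z ≤ m - u} := measureReal_nonneg
        change π _ * π _ ≤ a at h2
        nlinarith
      · have : {z | sampleUStatistic f z ≤ m - u} = (∅ : Set (FiniteSample X)) := by
          ext z
          have := hUnn z
          simp only [Set.mem_ofPred_eq, Set.mem_empty_iff_false, iff_false, not_le]
          linarith
        rw [this, hπ, measureReal_empty]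
        positivity
    have hunion : π {z | u ≤ |sampleUStatistic f z - m|}
        ≤ π {z | m + u ≤ sampleUStatistic f z} + π {z | sampleUStatistic f z ≤ m - u} :=
      (measureReal_mono (fun z hz => by
        rcases le_abs.1 (show u ≤ |sampleUStatistic f z - m| from hz) with h | h
        · exact Or.inl (show m + u ≤ sampleUStatistic f z by linarith)
        · exact Or.inr (show sampleUStatistic f z ≤ m - u by linarith))).trans
        (measureReal_union_le _ _)
    -- The total is at most `(5 + 1 / 144) * a`, below `6 * a < 4 * r * a`.
    nlinarith

end Concentration

/-! ### Normalisation of the intensity and the theorem. -/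

lemma ae_le_toReal_eLpNorm_top {α : Type*} [MeasurableSpace α] {μ : Measure α} {f : α → ℝ}
    (hf : eLpNorm f ⊤ μ ≠ ⊤) : ∀ᵐ x ∂μ, f x ≤ (eLpNorm f ⊤ μ).toReal := by
  rw [eLpNorm_exponent_top] at hf ⊢
  filter_upwards [ae_le_eLpNormEssSup (f := f) (μ := μ)] with x hx
  have h1 := ENNReal.toReal_mono hf hx
  rw [toReal_enorm] at h1
  exact (Real.le_norm_self _).trans h1

lemma pi_const_smul {ι X : Type*} [Fintype ι] [MeasurableSpace X] (μ : Measure X)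
    [IsFiniteMeasure μ] (a : NNReal) :
    (Measure.pi fun _ : ι => a • μ) = a ^ Fintype.card ι • Measure.pi fun _ : ι => μ := by
  refine Measure.pi_eq fun s _ => ?_
  simp only [Measure.smul_apply, Measure.pi_pi, ENNReal.smul_def, smul_eq_mul,
    Finset.prod_mul_distrib, Finset.prod_const, Finset.card_univ, ENNReal.coe_pow]

theorem mainTheorem3 {X : Type*} [MetricSpace X] [PolishSpace X] [MeasurableSpace X] [BorelSpace X]
    (μ : Measure X) [IsLocallyFiniteMeasure μ] [NullSingletonClass μ]
    {Ω : Type*} [MeasurableSpace Ω] (P : Measure Ω) [IsProbabilityMeasure P]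
    (η : Ω → Set X) (hη : IsPoissonProcess μ P η)
    (k : ℕ) (hk : 1 ≤ k) (f : (Fin k → X) → ℝ) (hf_meas : Measurable f)
    (hf_int : Integrable f (Measure.pi fun _ : Fin k => μ))
    (hf_nonneg : ∀ x, 0 ≤ f x)
    (hf_ne : ¬ f =ᵐ[Measure.pi fun _ : Fin k => μ] 0)
    (hf_bdd : eLpNorm f ⊤ (Measure.pi fun _ : Fin k => μ) ≠ ⊤)
    (δ : ℝ) (hδ : 0 < δ) (hf_loc : IsLocalKernel f δ)
    (m : ℝ) (hm : IsMedian P (fun ω => uStatistic f (η ω)) m)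
    (u : ℝ) (hu : 0 < u)
    (hE : (⨆ x : X, μ (Metric.closedBall x δ)) ^ k * ENNReal.ofReal (Real.exp (2 * (k : ℝ)))
        * eLpNorm f ⊤ (Measure.pi fun _ : Fin k => μ) ≤ ENNReal.ofReal (u ^ 2 / (u + m))) :
    P {ω | u ≤ |uStatistic f (η ω) - m|} ≤
      4 * μ Set.univ * ENNReal.ofReal (Real.exp (-(1 / (4 * (k : ℝ) ^ 2)
        * (eLpNorm f ⊤ (Measure.pi fun _ : Fin k => μ)).toReal ^ (-(1 / (k : ℝ)))
        * (u ^ 2 / (u + m)) ^ (1 / (k : ℝ))))) := by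
  rcases eq_or_ne (μ Set.univ) ⊤ with htop | hfin
  · rw [htop, ENNReal.mul_top (by norm_num), ENNReal.top_mul
      (by simpa using Real.exp_pos _)]
    exact le_top
  have : IsFiniteMeasure μ := ⟨lt_top_iff_ne_top.2 hfin⟩
  have : Nonempty (Fin k) := ⟨⟨0, hk⟩⟩
  have hμ0 : μ Set.univ ≠ 0 := by
    intro h
    apply hf_ne
    have : Measure.pi (fun _ : Fin k => μ) = 0 := by
      rw [← Measure.measure_univ_eq_zero, Measure.pi_univ]
      exact Finset.prod_eq_zero (Finset.mem_univ ⟨0, hk⟩) h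
    simp [Filter.EventuallyEq, this]
  have : Nonempty X := by
    by_contra h
    rw [not_nonempty_iff] at h
    exact hμ0 (by rw [Set.univ_eq_empty_iff.2 h, measure_empty])
  set r : NNReal := (μ Set.univ).toNNReal with hrdef
  have hr : r ≠ 0 := by
    rw [hrdef, Ne, ENNReal.toNNReal_eq_zero_iff]
    tauto
  have hrμ : (r : ENNReal) = μ Set.univ := ENNReal.coe_toNNReal hfin
  set ρ : Measure X := r⁻¹ • μ with hρ
  have hμρ : μ = r • ρ := by rw [hρ, smul_smul, mul_inv_cancel₀ hr, one_smul]
  have hρprob : IsProbabilityMeasure ρ := by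
    constructor
    rw [hρ, Measure.smul_apply, ENNReal.smul_def, smul_eq_mul, ← hrμ, ← ENNReal.coe_mul,
      inv_mul_cancel₀ hr, ENNReal.coe_one]
  have hρatom : NullSingletonClass ρ := ⟨fun x => by
    rw [hρ, Measure.smul_apply, measure_singleton, smul_zero]⟩
  obtain ⟨τ, hτ⟩ := exists_measurableEmbedding_real X
  have hlaw : ∀ D : Set ℝ, MeasurableSet D → P {ω | uStatistic f (η ω) ∈ D}
      = poissonSampleLaw r ρ {z | sampleUStatistic f z ∈ D} := fun D hD =>
    hη.measure_uStatistic hτ r ρ hμρ hf_meas hD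
  have hm1 : 1 / 2 ≤ (poissonSampleLaw r ρ).real {z | sampleUStatistic f z ≤ m} := by
    have h1 := hm.1.trans (hlaw (Set.Iic m) measurableSet_Iic).le
    have h2 := ENNReal.toReal_mono (measure_ne_top _ _) h1
    simpa [measureReal_def] using h2
  have hm2 : 1 / 2 ≤ (poissonSampleLaw r ρ).real {z | m ≤ sampleUStatistic f z} := by
    have h1 := hm.2.trans (hlaw (Set.Ici m) measurableSet_Ici).le
    have h2 := ENNReal.toReal_mono (measure_ne_top _ _) h1
    simpa [measureReal_def] using h2
  have hm0 : 0 ≤ m := by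
    by_contra hneg
    push Not at hneg
    have : {z | sampleUStatistic f z ≤ m} = (∅ : Set (FiniteSample X)) := by
      ext z
      have := sampleUStatistic_nonneg hf_nonneg z
      simp only [Set.mem_ofPred_eq, Set.mem_empty_iff_false, iff_false, not_le]
      linarith
    rw [this, measureReal_empty] at hm1
    norm_num at hm1
  set c := (eLpNorm f ⊤ (Measure.pi fun _ : Fin k => μ)).toReal with hcdef
  have hc : 0 < c := by
    refine ENNReal.toReal_pos (fun h => hf_ne ?_) hf_bdd
    exact (eLpNorm_eq_zero_iff hf_int.aestronglyMeasurable (by simp)).1 h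
  have hfc : ∀ᵐ x ∂(Measure.pi fun _ : Fin k => ρ), f x ≤ c := by
    rw [hρ, pi_const_smul]
    exact Measure.ae_smul_measure (ae_le_toReal_eLpNorm_top hf_bdd) _
  have hk0 : (k : ℝ) ≠ 0 := by positivity
  set v := u ^ 2 / (u + m) with hv
  have hv0 : 0 < v := by positivity
  -- The solution of `c * Q ^ k = u ^ 2 / (u + m)`. Taking `k`-th roots in the assumption on `u`
  -- turns it into `μ (closedBall x δ) * e² ≤ Q`.
  set Q := (v / c) ^ (1 / (k : ℝ)) with hQdef
  have hQ : 0 < Q := by positivity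
  have hQk : Q ^ k = v / c := by
    rw [hQdef, ← Real.rpow_natCast, ← Real.rpow_mul (by positivity), one_div_mul_cancel hk0,
      Real.rpow_one]
  have hball : ∀ x, r * ρ.real (Metric.closedBall x δ) * Real.exp 2 ≤ Q := by
    intro x
    have e1 : r * ρ.real (Metric.closedBall x δ) = μ.real (Metric.closedBall x δ) := by
      have h := congrArg (fun ν : Measure X => ν (Metric.closedBall x δ)) hμρ
      simp only [Measure.smul_apply, ENNReal.smul_def, smul_eq_mul] at h
      rw [measureReal_def, measureReal_def, h, ENNReal.toReal_mul, ENNReal.coe_toReal]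
    rw [e1]
    have h1 : μ (Metric.closedBall x δ) ^ k * ENNReal.ofReal (Real.exp (2 * (k : ℝ)))
        * eLpNorm f ⊤ (Measure.pi fun _ : Fin k => μ) ≤ ENNReal.ofReal v := by
      refine le_trans ?_ hE
      gcongr
      exact le_iSup (fun x => μ (Metric.closedBall x δ)) x
    have h2 := ENNReal.toReal_mono ENNReal.ofReal_ne_top h1
    rw [ENNReal.toReal_mul, ENNReal.toReal_mul, ENNReal.toReal_pow,
      ENNReal.toReal_ofReal (Real.exp_pos _).le, ENNReal.toReal_ofReal hv0.le, ← hcdef,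
      ← le_div_iff₀ hc, ← hQk, mul_comm 2, Real.exp_nat_mul, ← mul_pow] at h2
    exact le_of_pow_le_pow_left₀ (by omega) hQ.le h2
  have hcore := poissonSampleLaw_abs_sub_median_ge_le hr ρ hk hf_meas hf_nonneg hc hfc hf_loc hQ
    hball hm0 hm1 hm2 hu (by rw [hQk, mul_div_cancel₀ _ hc.ne'])
  have hexp : 1 / (4 * (k : ℝ) ^ 2) * c ^ (-(1 / (k : ℝ))) * v ^ (1 / (k : ℝ))
      = Q / (4 * (k : ℝ) ^ 2) := by
    rw [hQdef, Real.div_rpow hv0.le hc.le, Real.rpow_neg hc.le]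
    field_simp
  rw [hexp]
  have hD : MeasurableSet {y : ℝ | u ≤ |y - m|} :=
    measurableSet_le measurable_const (measurable_id.sub_const m).abs
  have h1 := hlaw _ hD
  calc P {ω | u ≤ |uStatistic f (η ω) - m|}
      = poissonSampleLaw r ρ {z | u ≤ |sampleUStatistic f z - m|} := h1
    _ = ENNReal.ofReal ((poissonSampleLaw r ρ).real {z | u ≤ |sampleUStatistic f z - m|}) :=
        (ENNReal.ofReal_toReal (measure_ne_top _ _)).symm
    _ ≤ ENNReal.ofReal (4 * r * Real.exp (-(Q / (4 * (k : ℝ) ^ 2)))) :=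
        ENNReal.ofReal_le_ofReal hcore
    _ = 4 * μ Set.univ * ENNReal.ofReal (Real.exp (-(Q / (4 * (k : ℝ) ^ 2)))) := by
        rw [ENNReal.ofReal_mul (by positivity), ENNReal.ofReal_mul (by norm_num),
          ENNReal.ofReal_coe_nnreal, hrμ]
        norm_num
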